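/- **Setting.** Let $Y = XB + V$, where $X\in\mathbb R^{n\times p}$ is a fixed design matrix of rank $p<n$, $B\in\mathbb R^{p\times d}$, and the rows $V_1,\dots,V_n\in\mathbb R^d$ of $V$ are i.i.d. with mean $0$ and covariance matrix $\Sigma\neq 0$. Let $\mathcal C\in\mathbb R^{m\times p}$ have rank $m$, $1\le m\le p$, and let $H_0$ be the hypothesis $\mathcal C B=0$. Put $$P=X(X^\top X)^{-1}\mathcal C^\top\{\mathcal C(X^\top X)^{-1}\mathcal C^\top\}^{-1}\mathcal C(X^\top X)^{-1}X^\top,\quad P_0=X(X^\top X)^{-1}X^\top-P,\quad \bar P_0=I_n-P_0,$$ let $\theta\in\mathbb R^n$ solve $(\bar P_0\circ\bar P_0)\theta=(P_{11},\dots,P_{nn})^\top$ ($\circ$ is the entrywise product), and let $P_\theta=P-\bar P_0\,\mathrm{diag}(\theta)\,\bar P_0=(P_{ij,\theta})$. With $\hat B_0$ the least squares estimator of $B$ under the constraint $\mathcal C B=0$, and $Y_k$, $X_k$ the $k$th rows of $Y$, $X$ written as column vectors, define $$U_n=|PY|_F^2-\sum_{k=1}^n\theta_k\,|Y_k-\hat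 B_0^\top X_k|^2,\qquad \mathcal G_n=\mathrm{tr}(Z^\top P_\theta Z),$$ where the rows of $Z\in\mathbb R^{n\times d}$ are i.i.d. $N(0,\Sigma)$. Let $\varsigma=|\Sigma|_F$ be the Frobenius norm of $\Sigma$, $M_q=\mathbb E|V_1^\top V_2/\varsigma|^q$, $L_q=\mathbb E|V_1^\top\Sigma V_1/\varsigma^2|^{q/2}$ (both in $[0,\infty]$), let $$\Delta_{q,\theta}=\frac{\sum_{i}\sum_{j\ne i}|P_{ij,\theta}|^q}{m^{q/2}}M_q+\frac{\sum_i(\sum_{j\neq i}P_{ij,\theta}^2)^{q/2}}{m^{q/2}}L_q,$$ and let $\rho(S,T)=\sup_{z\in\mathbb R}|\mathbb P(S\le z)-\mathbb P(T\le z)|$. **Theorem.** Let $q=2+\delta$ with $0<\delta\le1$ and let $0<\varpi_0<1/2$. There are a constant $C_q>0$ depending only on $q$ and a constant $C>0$ depending only on $\varpi_0$ such that the following holds. If $\max_i P_{ii,0}\le\varpi_0$ (where $P_{ii,0}$ are the diagonal entries of $P_0$) and $H_0$ is true, then $P_{ii,\theta}=0$ for all $i$, $U_n=\mathrm{tr}(V^\top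 P_\theta V)$, and $$\rho(U_n,\mathcal G_n)\le C_q\,\Delta_{q,\theta}^{1/(2q+1)}+C\Bigl(\frac1m\sum_{i=1}^nP_{ii}^2\Bigr)^{1/5}.$$ Consequently, along any sequence of such models (in which $n,p,m,d,X,\mathcal C,B$ and the distribution of $V_1$ may all vary, with $q$ and $\varpi_0$ fixed) for which $\frac1m\sum_iP_{ii}^2\to0$ and $\Delta_{q,\theta}\to0$, the right-hand side and hence $\rho(U_n,\mathcal G_n)$ tend to $0$. -/

import Mathlib

open MeasureTheory ProbabilityTheory Filter Topology Matrix
open scoped ENNReal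

universe u

namespace ManovaU

/-- The squared Frobenius norm `|A|_F ^ 2` of a real matrix. -/
def frobSq {a b : ℕ} (A : Matrix (Fin a) (Fin b) ℝ) : ℝ := ∑ i, ∑ j, A i j ^ 2

/-- The Kolmogorov distance `sup_z |ℙ(S ≤ z) - ℙ'(T ≤ z)|` between the distributions of a real
random variable `S` on `(Ω, ℙ)` and a real random variable `T` on `(Ω', ℙ')`. -/
noncomputable def kolmogorovDist {Ω Ω' : Type*} [MeasurableSpace Ω] [MeasurableSpace Ω']
    (P : Measure Ω) (S : Ω → ℝ) (P' : Measure Ω') (T : Ω' → ℝ) : ℝ :=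
  ⨆ z : ℝ, |P.real {ω | S ω ≤ z} - P'.real {ω | T ω ≤ z}|

/-! ### Deterministic matrices attached to the design `X` and the constraint matrix `C` -/

section Design

variable {n p m d : ℕ} (X : Matrix (Fin n) (Fin p) ℝ) (C : Matrix (Fin m) (Fin p) ℝ)

/-- `P = X (XᵀX)⁻¹ Cᵀ {C (XᵀX)⁻¹ Cᵀ}⁻¹ C (XᵀX)⁻¹ Xᵀ`. -/
noncomputable def projP : Matrix (Fin n) (Fin n) ℝ :=
  X * (Xᵀ * X)⁻¹ * Cᵀ * (C * (Xᵀ * X)⁻¹ * Cᵀ)⁻¹ * C * (Xᵀ * X)⁻¹ * Xᵀ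

/-- `P₀ = X (XᵀX)⁻¹ Xᵀ - P`, the projection matrix of the model restricted to `C B = 0`. -/
noncomputable def projP0 : Matrix (Fin n) (Fin n) ℝ :=
  X * (Xᵀ * X)⁻¹ * Xᵀ - projP X C

/-- `P̄₀ = I - P₀`. -/
noncomputable def barP0 : Matrix (Fin n) (Fin n) ℝ := 1 - projP0 X C

/-- The solution `θ` of the linear system `(P̄₀ ∘ P̄₀) θ = (P₁₁, …, Pₙₙ)ᵀ`, where `∘` is the
entrywise product. -/
noncomputable def theta : Fin n → ℝ :=
  (barP0 X C ⊙ barP0 X C)⁻¹ *ᵥ (projP X C).diag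

/-- `P_θ = P - P̄₀ diag(θ) P̄₀`. -/
noncomputable def Ptheta : Matrix (Fin n) (Fin n) ℝ :=
  projP X C - barP0 X C * Matrix.diagonal (theta X C) * barP0 X C

/-- The least squares estimator `B̂` of the coefficient matrix subject to the constraint
`C B̂ = 0`, for the observation matrix `Y`; `constrainedLSE_spec` proves that it is one. -/
noncomputable def constrainedLSE (Y : Matrix (Fin n) (Fin d) ℝ) : Matrix (Fin p) (Fin d) ℝ :=
  (Xᵀ * X)⁻¹ * Xᵀ * Y -
    (Xᵀ * X)⁻¹ * Cᵀ * (C * (Xᵀ * X)⁻¹ * Cᵀ)⁻¹ * C * (Xᵀ * X)⁻¹ * Xᵀ * Y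

/-- The statistic `Qₙ = |P Y|_F ^ 2`. -/
noncomputable def statQ (Y : Matrix (Fin n) (Fin d) ℝ) : ℝ := frobSq (projP X C * Y)

/-- The modified statistic `Uₙ = Qₙ - ∑ₖ θₖ (Yₖ - B̂ᵀXₖ)ᵀ(Yₖ - B̂ᵀXₖ)`, where `B̂` is the
constrained least squares estimator and `Yₖ`, `Xₖ` are the `k`-th rows of `Y`, `X`. -/
noncomputable def statU (Y : Matrix (Fin n) (Fin d) ℝ) : ℝ :=
  statQ X C Y - ∑ k, theta X C k * ∑ j, (Y - X * constrainedLSE X C Y) k j ^ 2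

theorem isUnit_of_rank {a : ℕ} {A : Matrix (Fin a) (Fin a) ℝ} (h : A.rank = a) :
    IsUnit A.det := by
  have h2 : Function.Surjective A.mulVecLin := by
    rw [← LinearMap.range_eq_top]
    apply Submodule.eq_top_of_finrank_eq
    rw [Module.finrank_fin_fun]
    exact h
  have h3 : Function.Injective A.mulVec := LinearMap.injective_iff_surjective.mpr h2
  rw [← Matrix.isUnit_iff_isUnit_det]
  exact Matrix.mulVec_injective_iff_isUnit.mp h3

theorem isUnit_gram (hX : X.rank = p) : IsUnit (Xᵀ * X).det :=
  isUnit_of_rank (by rw [Matrix.rank_transpose_mul_self, hX])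

theorem gram_inv_symm : (Xᵀ * X)⁻¹ᵀ = (Xᵀ * X)⁻¹ := by
  rw [Matrix.transpose_nonsing_inv]
  simp

theorem isUnit_constraint_gram (hX : X.rank = p) (hC : C.rank = m) :
    IsUnit (C * (Xᵀ * X)⁻¹ * Cᵀ).det := by
  have hu := isUnit_gram X hX
  have e : C * (Xᵀ * X)⁻¹ * Cᵀ = (X * (Xᵀ * X)⁻¹ * Cᵀ)ᵀ * (X * (Xᵀ * X)⁻¹ * Cᵀ) := by
    simp only [Matrix.transpose_mul, gram_inv_symm, Matrix.transpose_transpose]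
    calc C * (Xᵀ * X)⁻¹ * Cᵀ = C * ((Xᵀ * X)⁻¹ * (Xᵀ * X)) * (Xᵀ * X)⁻¹ * Cᵀ := by
          rw [Matrix.nonsing_inv_mul _ hu, Matrix.mul_one]
      _ = _ := by simp only [Matrix.mul_assoc]
  apply isUnit_of_rank
  rw [e, Matrix.rank_transpose_mul_self]
  apply le_antisymm
  · simpa using Matrix.rank_le_width (X * (Xᵀ * X)⁻¹ * Cᵀ)
  · have h1 : Xᵀ * (X * (Xᵀ * X)⁻¹ * Cᵀ) = Cᵀ := by
      calc Xᵀ * (X * (Xᵀ * X)⁻¹ * Cᵀ) = ((Xᵀ * X) * (Xᵀ * X)⁻¹) * Cᵀ := by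
            simp only [Matrix.mul_assoc]
        _ = Cᵀ := by rw [Matrix.mul_nonsing_inv _ hu, Matrix.one_mul]
    have h2 := Matrix.rank_mul_le_right Xᵀ (X * (Xᵀ * X)⁻¹ * Cᵀ)
    rw [h1, Matrix.rank_transpose, hC] at h2
    exact h2

theorem frobSq_eq_trace {a b : ℕ} (A : Matrix (Fin a) (Fin b) ℝ) :
    frobSq A = (Aᵀ * A).trace := by
  simp only [frobSq, Matrix.trace, Matrix.diag, Matrix.mul_apply, Matrix.transpose_apply]
  rw [Finset.sum_comm]
  simp only [sq]

/-- `constrainedLSE` satisfies the constraint and minimises the residual sum of squares among all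
coefficient matrices that satisfy it. -/
theorem constrainedLSE_spec (hX : X.rank = p) (hC : C.rank = m) (Y : Matrix (Fin n) (Fin d) ℝ) :
    C * constrainedLSE X C Y = 0 ∧ ∀ B : Matrix (Fin p) (Fin d) ℝ, C * B = 0 →
      frobSq (Y - X * constrainedLSE X C Y) ≤ frobSq (Y - X * B) := by
  have hu := isUnit_gram X hX
  have hk := isUnit_constraint_gram X C hX hC
  set L : Matrix (Fin p) (Fin d) ℝ := constrainedLSE X C Y with hL
  have hCL : C * L = 0 := by
    have : C * L = C * (Xᵀ * X)⁻¹ * Xᵀ * Y -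
        ((C * (Xᵀ * X)⁻¹ * Cᵀ) * (C * (Xᵀ * X)⁻¹ * Cᵀ)⁻¹) * (C * (Xᵀ * X)⁻¹ * Xᵀ * Y) := by
      rw [hL, constrainedLSE, Matrix.mul_sub]
      simp only [Matrix.mul_assoc]
    rw [this, Matrix.mul_nonsing_inv _ hk, Matrix.one_mul, sub_self]
  refine ⟨hCL, fun B hB => ?_⟩
  have hR : Xᵀ * (Y - X * L) =
      Cᵀ * ((C * (Xᵀ * X)⁻¹ * Cᵀ)⁻¹ * C * (Xᵀ * X)⁻¹ * Xᵀ * Y) := by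
    have : Xᵀ * (Y - X * L) = Xᵀ * Y - ((Xᵀ * X) * (Xᵀ * X)⁻¹) * (Xᵀ * Y) +
        ((Xᵀ * X) * (Xᵀ * X)⁻¹) *
          (Cᵀ * ((C * (Xᵀ * X)⁻¹ * Cᵀ)⁻¹ * C * (Xᵀ * X)⁻¹ * Xᵀ * Y)) := by
      rw [hL, constrainedLSE, Matrix.mul_sub, Matrix.mul_sub, Matrix.mul_sub]
      simp only [Matrix.mul_assoc]
      abel
    rw [this, Matrix.mul_nonsing_inv _ hu, Matrix.one_mul, Matrix.one_mul, sub_self, zero_add]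
  have hD : C * (L - B) = 0 := by rw [Matrix.mul_sub, hCL, hB, sub_self]
  have hcross : (X * (L - B))ᵀ * (Y - X * L) = 0 := by
    rw [Matrix.transpose_mul, Matrix.mul_assoc, hR, ← Matrix.mul_assoc, ← Matrix.transpose_mul,
      hD, Matrix.transpose_zero, Matrix.zero_mul]
  have hcross' : (Y - X * L)ᵀ * (X * (L - B)) = 0 := by
    have := congrArg Matrix.transpose hcross
    rwa [Matrix.transpose_mul, Matrix.transpose_transpose, Matrix.transpose_zero] at this
  have hsplit : Y - X * B = (Y - X * L) + X * (L - B) := by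
    rw [Matrix.mul_sub]; abel
  rw [hsplit, frobSq_eq_trace, frobSq_eq_trace (_ + _), Matrix.transpose_add, Matrix.add_mul,
    Matrix.mul_add, Matrix.mul_add, hcross, hcross', add_zero, zero_add, Matrix.trace_add,
    ← frobSq_eq_trace (X * (L - B))]
  have : 0 ≤ frobSq (X * (L - B)) :=
    Finset.sum_nonneg fun i _ => Finset.sum_nonneg fun j _ => sq_nonneg _
  linarith

end Design

/-- The quadratic form `tr(vᵀ K v) = ∑ᵢ ∑ⱼ Kᵢⱼ vᵢᵀ vⱼ` of the matrix with rows
`v₁, …, vₙ ∈ ℝᵈ`. -/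
noncomputable def quadForm {n d : ℕ} (K : Matrix (Fin n) (Fin n) ℝ)
    (v : Fin n → EuclideanSpace ℝ (Fin d)) : ℝ :=
  ((Matrix.of fun i j => v i j)ᵀ * K * (Matrix.of fun i j => v i j)).trace

/-! ### Moment quantities of the error distribution -/

section Moments

variable {d : ℕ} (ν : Measure (EuclideanSpace ℝ (Fin d)))

/-- The covariance matrix `Σ` of the distribution `ν`. -/
noncomputable def covMat : Matrix (Fin d) (Fin d) ℝ :=
  Matrix.of fun j k => cov[fun x : EuclideanSpace ℝ (Fin d) => x j, fun x => x k; ν]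

/-- `ς = |Σ|_F`. -/
noncomputable def varsig : ℝ := √(frobSq (covMat ν))

/-- `M_q = 𝔼|V₁ᵀV₂ / ς| ^ q` for independent `V₁, V₂` with distribution `ν`
(`∞` if this moment is infinite). -/
noncomputable def momentM (q : ℝ) : ℝ≥0∞ :=
  ∫⁻ x, ∫⁻ y, ENNReal.ofReal (|inner ℝ x y / varsig ν| ^ q) ∂ν ∂ν

/-- `L_q = 𝔼|V₁ᵀ Σ V₁ / ς²| ^ (q/2)` for `V₁` with distribution `ν`
(`∞` if this moment is infinite). -/
noncomputable def momentL (q : ℝ) : ℝ≥0∞ :=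
  ∫⁻ x, ENNReal.ofReal (|(x.ofLp ⬝ᵥ covMat ν *ᵥ x.ofLp) / varsig ν ^ 2| ^ (q / 2)) ∂ν

end Moments

/-- The multivariate linear regression model `Y = X B + V` with `n` observations, `p` predictors,
responses in `ℝᵈ`, and a constraint matrix `C` with `m` rows for the hypothesis `C B = 0`.
The rows `V₁, …, Vₙ` of `V` are i.i.d. with mean zero and covariance matrix `Σ ≠ 0`. -/
structure RegressionModel where
  /-- sample size -/
  n : ℕ
  /-- number of predictors -/
  p : ℕ
  /-- number of linear constraints -/
  m : ℕ
  /-- dimension of the responses -/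
  d : ℕ
  /-- design matrix -/
  X : Matrix (Fin n) (Fin p) ℝ
  /-- constraint matrix -/
  C : Matrix (Fin m) (Fin p) ℝ
  /-- coefficient matrix -/
  B : Matrix (Fin p) (Fin d) ℝ
  one_le_m : 1 ≤ m
  m_le_p : m ≤ p
  p_lt_n : p < n
  rank_X : X.rank = p
  rank_C : C.rank = m
  /-- sample space -/
  Ω : Type u
  [mΩ : MeasurableSpace Ω]
  /-- underlying probability -/
  prob : Measure Ω
  [isProb : IsProbabilityMeasure prob]
  /-- error vectors -/
  V : Fin n → Ω → EuclideanSpace ℝ (Fin d)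
  /-- common distribution of the error vectors -/
  law : Measure (EuclideanSpace ℝ (Fin d))
  hasLaw : ∀ i, HasLaw (V i) law prob
  indep : iIndepFun V prob
  memLp_two : MemLp id 2 law
  mean_zero : ∫ x, x ∂law = 0
  cov_ne_zero : covMat law ≠ 0

attribute [instance] RegressionModel.mΩ RegressionModel.isProb

namespace RegressionModel

variable (M : RegressionModel.{u})

/-- The null hypothesis `H₀ : C B = 0`. -/
def Null : Prop := M.C * M.B = 0

/-- The observation matrix `Y = X B + V`. -/
noncomputable def Y (ω : M.Ω) : Matrix (Fin M.n) (Fin M.d) ℝ :=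
  M.X * M.B + Matrix.of fun i j => M.V i ω j

/-- The projection matrix `P`. -/
noncomputable def P : Matrix (Fin M.n) (Fin M.n) ℝ := projP M.X M.C

/-- The projection matrix `P₀`. -/
noncomputable def P0 : Matrix (Fin M.n) (Fin M.n) ℝ := projP0 M.X M.C

/-- The matrix `P_θ`. -/
noncomputable def Pθ : Matrix (Fin M.n) (Fin M.n) ℝ := Ptheta M.X M.C

/-- The modified test statistic `Uₙ`, a function of the observations. -/
noncomputable def U (ω : M.Ω) : ℝ := statU M.X M.C (M.Y ω)

/-- `m⁻¹ ∑ᵢ Pᵢᵢ²`. -/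
noncomputable def imbalance : ℝ := (∑ i, M.P i i ^ 2) / M.m

/-- `Δ_{q,θ} = m^{-q/2} ∑ᵢ ∑_{j≠i} |P_{ij,θ}|^q M_q + m^{-q/2} ∑ᵢ (∑_{j≠i} P_{ij,θ}²)^{q/2} L_q`,
as an extended nonnegative number. -/
noncomputable def Delta (q : ℝ) : ℝ≥0∞ :=
  ENNReal.ofReal ((∑ i, ∑ j with j ≠ i, |M.Pθ i j| ^ q) / (M.m : ℝ) ^ (q / 2)) *
      momentM M.law q +
    ENNReal.ofReal ((∑ i, (∑ j with j ≠ i, M.Pθ i j ^ 2) ^ (q / 2)) / (M.m : ℝ) ^ (q / 2)) *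
      momentL M.law q

/-- The joint distribution of `Z₁, …, Zₙ`, i.i.d. `N(0, Σ)`. -/
noncomputable def gaussLaw : Measure (Fin M.n → EuclideanSpace ℝ (Fin M.d)) :=
  Measure.pi fun _ => multivariateGaussian 0 (covMat M.law)

/-- `ρ(Uₙ, 𝒢ₙ)`, where `𝒢ₙ = tr(Zᵀ P_θ Z)` with `Z₁, …, Zₙ` i.i.d. `N(0, Σ)`. -/
noncomputable def rho : ℝ :=
  kolmogorovDist M.prob M.U M.gaussLaw (quadForm M.Pθ)

/-- The bound `c_q Δ_{q,θ}^{1/(2q+1)} + c (m⁻¹ ∑ᵢ Pᵢᵢ²)^{1/5}`. -/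
noncomputable def bound (q cq c : ℝ) : ℝ≥0∞ :=
  ENNReal.ofReal cq * M.Delta q ^ (1 / (2 * q + 1)) +
    ENNReal.ofReal (c * M.imbalance ^ (1 / 5 : ℝ))

end RegressionModel

end ManovaU

/-! Write Q for `barP0` and D for diag(θ). Under the null hypothesis Q annihilates XB and P = PQ, so
`statU` is the quadratic form of the errors with kernel P_θ = P - QDQ. The diagonal of QDQ is
(Q∘Q)θ, so θ is exactly the vector that clears the diagonal of P_θ. The system is solvable because Q
is a symmetric idempotent with diagonal entries above 1/2, which makes Q∘Q positive definite
(`sum_sq_le_hadamard_form`). The same bound gives |P_θ|_F² ≥ m - c⁻¹ ∑ P_ii² with c = (1-w)(1-2w).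

If m⁻¹ ∑ P_ii² exceeds c/2, the second term of the bound is at least one and nothing remains to be
shown; the exponent 1/5 plays no deeper role. Otherwise |P_θ|_F² ≥ m/2, and the first term alone
suffices.

In that case two estimates are made at the scale ε = η τ with τ = √m ς. The first is Lindeberg
replacement (`ofReal_abs_integral_quadForm_sub_le`). Since the diagonal vanishes, the form is affine
in each row, so exchanging a row for a Gaussian one with the same mean and covariance costs only a
Taylor remainder of order q. Rosenthal's inequality bounds the q-th moment of the linear
coefficient, and the exchanges sum to a multiple of η^(-q) Δ.

The second is anti-concentration of the Gaussian form (`measure_abs_sub_le_le`). Diagonalizing K ⊗ Σ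
turns it into ∑ λ_k x_k² with independent standard normal x_k and ∑ λ_k² = |K|_F² |Σ|_F² ≥ τ²/2. Its
characteristic function is therefore at most (τ|t|)^(-1/2), and intervals of length of order ε have
probability of order η^(1/2), without any assumption on how the eigenvalues are spread.

Smoothing (`ofReal_kolmogorovDist_le`) adds the two errors, and η = Δ^(2/(2q+1)) equalizes them,
which is the source of the exponent 1/(2q+1). -/

namespace ManovaU

/-! ### Projection identities and the statistic under the null hypothesis. -/

section Design

variable {n p m d : ℕ} (X : Matrix (Fin n) (Fin p) ℝ) (C : Matrix (Fin m) (Fin p) ℝ)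

theorem constraint_gram_inv_symm :
    (C * (Xᵀ * X)⁻¹ * Cᵀ)⁻¹ᵀ = (C * (Xᵀ * X)⁻¹ * Cᵀ)⁻¹ := by
  rw [Matrix.transpose_nonsing_inv]
  simp only [Matrix.transpose_mul, gram_inv_symm, Matrix.transpose_transpose, Matrix.mul_assoc]

theorem projP_transpose : (projP X C)ᵀ = projP X C := by
  have h := constraint_gram_inv_symm X C
  simp only [Matrix.mul_assoc] at h
  simp only [projP, Matrix.transpose_mul, gram_inv_symm, Matrix.transpose_transpose,
    Matrix.mul_assoc, h]

theorem projP_eq_mul :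
    projP X C = X * ((Xᵀ * X)⁻¹ * (Cᵀ * ((C * (Xᵀ * X)⁻¹ * Cᵀ)⁻¹ * (C * ((Xᵀ * X)⁻¹ * Xᵀ))))) := by
  simp only [projP, Matrix.mul_assoc]

theorem hat_mul_design (hX : X.rank = p) : X * (Xᵀ * X)⁻¹ * Xᵀ * X = X := by
  rw [Matrix.mul_assoc, Matrix.mul_assoc, Matrix.nonsing_inv_mul _ (isUnit_gram X hX),
    Matrix.mul_one]

theorem projP_mul_design (hX : X.rank = p) :
    projP X C * X = X * (Xᵀ * X)⁻¹ * Cᵀ * (C * (Xᵀ * X)⁻¹ * Cᵀ)⁻¹ * C := by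
  rw [projP, Matrix.mul_assoc _ Xᵀ X, Matrix.mul_assoc _ (Xᵀ * X)⁻¹ (Xᵀ * X),
    Matrix.nonsing_inv_mul _ (isUnit_gram X hX), Matrix.mul_one]

theorem hat_mul_projP (hX : X.rank = p) : X * (Xᵀ * X)⁻¹ * Xᵀ * projP X C = projP X C := by
  rw [projP_eq_mul, ← Matrix.mul_assoc, hat_mul_design X hX]

theorem hat_transpose : (X * (Xᵀ * X)⁻¹ * Xᵀ)ᵀ = X * (Xᵀ * X)⁻¹ * Xᵀ := by
  simp only [Matrix.transpose_mul, gram_inv_symm, Matrix.transpose_transpose, Matrix.mul_assoc]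

theorem projP_mul_hat (hX : X.rank = p) : projP X C * (X * (Xᵀ * X)⁻¹ * Xᵀ) = projP X C := by
  have h := congrArg Matrix.transpose (hat_mul_projP X C hX)
  rwa [Matrix.transpose_mul, hat_transpose, projP_transpose] at h

theorem projP_mul_self (hX : X.rank = p) (hC : C.rank = m) :
    projP X C * projP X C = projP X C := by
  have hk := isUnit_constraint_gram X C hX hC
  nth_rewrite 2 [projP_eq_mul]
  rw [← Matrix.mul_assoc, projP_mul_design X C hX]
  calc _ = X * (Xᵀ * X)⁻¹ * Cᵀ * (C * (Xᵀ * X)⁻¹ * Cᵀ)⁻¹ * ((C * (Xᵀ * X)⁻¹ * Cᵀ) *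
        (C * (Xᵀ * X)⁻¹ * Cᵀ)⁻¹) * (C * ((Xᵀ * X)⁻¹ * Xᵀ)) := by simp only [Matrix.mul_assoc]
    _ = projP X C := by
        rw [Matrix.mul_nonsing_inv _ hk, Matrix.mul_one]
        simp only [projP, Matrix.mul_assoc]

theorem trace_projP (hX : X.rank = p) (hC : C.rank = m) : (projP X C).trace = m := by
  have hk := isUnit_constraint_gram X C hX hC
  rw [projP_eq_mul, Matrix.trace_mul_comm]
  calc _ = ((Xᵀ * X)⁻¹ * Cᵀ * ((C * (Xᵀ * X)⁻¹ * Cᵀ)⁻¹ * (C * ((Xᵀ * X)⁻¹ * (Xᵀ * X))))).trace := by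
        simp only [Matrix.mul_assoc]
    _ = (C * (Xᵀ * X)⁻¹ * Cᵀ * (C * (Xᵀ * X)⁻¹ * Cᵀ)⁻¹).trace := by
        rw [Matrix.nonsing_inv_mul _ (isUnit_gram X hX), Matrix.mul_one, ← Matrix.mul_assoc,
          Matrix.trace_mul_comm]
        simp only [Matrix.mul_assoc]
    _ = m := by rw [Matrix.mul_nonsing_inv _ hk, Matrix.trace_one, Fintype.card_fin]

theorem barP0_transpose : (barP0 X C)ᵀ = barP0 X C := by
  simp only [barP0, projP0, Matrix.transpose_sub, Matrix.transpose_one, hat_transpose,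
    projP_transpose]

/-- The hat matrix absorbs P, so P P₀ = P - P² = 0: the ranges of P and P₀ are orthogonal. -/
theorem projP_mul_barP0 (hX : X.rank = p) (hC : C.rank = m) :
    projP X C * barP0 X C = projP X C := by
  rw [barP0, projP0, Matrix.mul_sub, Matrix.mul_sub, projP_mul_hat X C hX,
    projP_mul_self X C hX hC, sub_self, sub_zero, Matrix.mul_one]

theorem barP0_mul_self (hX : X.rank = p) (hC : C.rank = m) :
    barP0 X C * barP0 X C = barP0 X C := by
  have h1 : X * (Xᵀ * X)⁻¹ * Xᵀ * barP0 X C = projP X C := by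
    rw [barP0, projP0, Matrix.mul_sub, Matrix.mul_sub, hat_mul_projP X C hX, Matrix.mul_one]
    have : X * (Xᵀ * X)⁻¹ * Xᵀ * (X * (Xᵀ * X)⁻¹ * Xᵀ) = X * (Xᵀ * X)⁻¹ * Xᵀ := by
      simp only [← Matrix.mul_assoc]
      rw [hat_mul_design X hX]
    rw [this]
    abel
  nth_rewrite 1 [barP0]
  rw [projP0, Matrix.sub_mul, Matrix.sub_mul, h1, projP_mul_barP0 X C hX hC, Matrix.one_mul,
    sub_self, sub_zero]

/-- P X ends in the factor C, so CB = 0 leaves P₀ X B = XB. This is the only place where the null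
hypothesis acts. -/
theorem barP0_mul_design_mul (hX : X.rank = p) {B : Matrix (Fin p) (Fin d) ℝ} (hB : C * B = 0) :
    barP0 X C * (X * B) = 0 := by
  have h1 : projP X C * (X * B) = 0 := by
    rw [← Matrix.mul_assoc, projP_mul_design X C hX, Matrix.mul_assoc, hB, Matrix.mul_zero]
  rw [barP0, projP0, Matrix.sub_mul, Matrix.sub_mul, h1,
    ← Matrix.mul_assoc (X * (Xᵀ * X)⁻¹ * Xᵀ) X B, hat_mul_design X hX, Matrix.one_mul, sub_zero,
    sub_self]

/-- Identifies the residuals in the correction term, which makes that term tr(Yᵀ Q D Q Y) with Q =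
`barP0`. -/
theorem design_mul_constrainedLSE (Y : Matrix (Fin n) (Fin d) ℝ) :
    Y - X * constrainedLSE X C Y = barP0 X C * Y := by
  rw [constrainedLSE, barP0, projP0, projP, Matrix.mul_sub, Matrix.sub_mul, Matrix.sub_mul,
    Matrix.one_mul]
  simp only [Matrix.mul_assoc]

theorem sum_mul_sum_sq_eq_trace (t : Fin n → ℝ) (R : Matrix (Fin n) (Fin d) ℝ) :
    ∑ k, t k * ∑ j, R k j ^ 2 = (Rᵀ * Matrix.diagonal t * R).trace := by
  rw [Matrix.mul_assoc, Matrix.trace_mul_comm, Matrix.trace]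
  refine Finset.sum_congr rfl fun k _ => ?_
  rw [Matrix.diag_apply, Matrix.mul_apply, Finset.mul_sum]
  refine Finset.sum_congr rfl fun j _ => ?_
  rw [Matrix.diagonal_mul, Matrix.transpose_apply]
  ring

theorem Ptheta_transpose : (Ptheta X C)ᵀ = Ptheta X C := by
  simp only [Ptheta, Matrix.transpose_sub, Matrix.transpose_mul, projP_transpose, barP0_transpose,
    Matrix.diagonal_transpose, Matrix.mul_assoc]

/-- Under the null hypothesis, the statistic is the quadratic form of the errors. -/
theorem statU_add_eq (hX : X.rank = p) (hC : C.rank = m) {B : Matrix (Fin p) (Fin d) ℝ}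
    (hB : C * B = 0) (W : Matrix (Fin n) (Fin d) ℝ) :
    statU X C (X * B + W) = (Wᵀ * Ptheta X C * W).trace := by
  have h0 := barP0_mul_design_mul X C hX hB
  have h1 : projP X C * (X * B) = 0 := by
    rw [← projP_mul_barP0 X C hX hC, Matrix.mul_assoc, h0, Matrix.mul_zero]
  have hPP : (projP X C)ᵀ * projP X C = projP X C := by
    rw [projP_transpose, projP_mul_self X C hX hC]
  rw [statU, statQ, design_mul_constrainedLSE, sum_mul_sum_sq_eq_trace, frobSq_eq_trace,
    Matrix.mul_add (projP X C), Matrix.mul_add (barP0 X C), h0, h1, zero_add, zero_add, Ptheta,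
      Matrix.mul_sub,
    Matrix.sub_mul, Matrix.trace_sub, Matrix.transpose_mul, Matrix.transpose_mul, barP0_transpose,
    Matrix.mul_assoc _ _ (projP X C * W), ← Matrix.mul_assoc _ (projP X C) W, hPP]
  simp only [Matrix.mul_assoc]

end Design

/-! ### Positive definiteness of the entrywise square of a projection. -/

section Theta

variable {n : ℕ} {Q : Matrix (Fin n) (Fin n) ℝ} {w : ℝ}

theorem sum_sq_row_eq_diag (hT : Qᵀ = Q) (hQ : Q * Q = Q) (i : Fin n) :
    ∑ j, Q i j ^ 2 = Q i i := by
  conv_rhs => rw [← hQ, Matrix.mul_apply]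
  refine Finset.sum_congr rfl fun j _ => ?_
  rw [sq, ← Matrix.transpose_apply Q j i, hT]

/-- The entrywise square of a symmetric idempotent with diagonal entries above `1/2` is bounded
below as a quadratic form, by diagonal dominance. -/
theorem sum_sq_le_hadamard_form (hT : Qᵀ = Q) (hQ : Q * Q = Q) (hw : w < 1 / 2)
    (hd : ∀ i, 1 - w ≤ Q i i) (x : Fin n → ℝ) :
    (1 - w) * (1 - 2 * w) * ∑ i, x i ^ 2 ≤ x ⬝ᵥ (Q ⊙ Q) *ᵥ x := by
  have hs : ∀ i j, Q i j = Q j i := fun i j => by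
    conv_lhs => rw [← hT, Matrix.transpose_apply]
  have e1 : x ⬝ᵥ (Q ⊙ Q) *ᵥ x = ∑ i, ∑ j, Q i j ^ 2 * (x i * x j) := by
    simp only [dotProduct, Matrix.mulVec, Matrix.hadamard_apply, Finset.mul_sum]
    exact Finset.sum_congr rfl fun i _ => Finset.sum_congr rfl fun j _ => by ring
  -- The rows of Q∘Q sum to Q_ii, so completing squares in the off-diagonal products leaves a sum of
  -- nonnegative terms. Below, only the terms with j = i are kept, giving the lower bound ∑ Q_ii (2
  -- Q_ii - 1) x_i² for the form.
  have e2 : ∑ i, ∑ j, Q i j ^ 2 * ((x i + x j) ^ 2) =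
      2 * (∑ i, Q i i * x i ^ 2) + 2 * (x ⬝ᵥ (Q ⊙ Q) *ᵥ x) := by
    have a1 : ∑ i, ∑ j, Q i j ^ 2 * x i ^ 2 = ∑ i, Q i i * x i ^ 2 :=
      Finset.sum_congr rfl fun i _ => by rw [← Finset.sum_mul, sum_sq_row_eq_diag hT hQ]
    have a2 : ∑ i, ∑ j, Q i j ^ 2 * x j ^ 2 = ∑ i, Q i i * x i ^ 2 := by
      rw [Finset.sum_comm, ← a1]
      exact Finset.sum_congr rfl fun i _ => Finset.sum_congr rfl fun j _ => by rw [hs j i]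
    have a3 : ∑ i, ∑ j, Q i j ^ 2 * ((x i + x j) ^ 2) = ∑ i, ∑ j, Q i j ^ 2 * x i ^ 2 +
        ∑ i, ∑ j, Q i j ^ 2 * x j ^ 2 + 2 * ∑ i, ∑ j, Q i j ^ 2 * (x i * x j) := by
      simp only [Finset.mul_sum, ← Finset.sum_add_distrib]
      exact Finset.sum_congr rfl fun i _ => Finset.sum_congr rfl fun j _ => by ring
    rw [a3, a1, a2, e1]
    ring
  have e3 : ∑ i, Q i i ^ 2 * ((2 * x i) ^ 2) ≤ ∑ i, ∑ j, Q i j ^ 2 * ((x i + x j) ^ 2) := by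
    refine Finset.sum_le_sum fun i _ => ?_
    have := Finset.single_le_sum (f := fun j => Q i j ^ 2 * ((x i + x j) ^ 2))
      (fun j _ => by positivity) (Finset.mem_univ i)
    simpa [two_mul] using this
  have e4 : ∑ i, (1 - w) * (1 - 2 * w) * x i ^ 2 ≤
      ∑ i, (Q i i ^ 2 * (2 * x i) ^ 2 - 2 * (Q i i * x i ^ 2)) / 2 := by
    refine Finset.sum_le_sum fun i _ => ?_
    have : (1 - w) * (1 - 2 * w) ≤ Q i i * (2 * Q i i - 1) := by nlinarith [hd i]
    nlinarith [sq_nonneg (x i)]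
  rw [← Finset.sum_div, Finset.sum_sub_distrib, ← Finset.mul_sum, ← Finset.mul_sum] at e4
  linarith

theorem isUnit_det_hadamard (hT : Qᵀ = Q) (hQ : Q * Q = Q) (hw : w < 1 / 2)
    (hd : ∀ i, 1 - w ≤ Q i i) : IsUnit (Q ⊙ Q).det := by
  rw [← Matrix.isUnit_iff_isUnit_det, ← Matrix.mulVec_injective_iff_isUnit]
  intro x y hxy
  have h0 : (Q ⊙ Q) *ᵥ (x - y) = 0 := by rw [Matrix.mulVec_sub]; simp [hxy]
  have h1 := sum_sq_le_hadamard_form hT hQ hw hd (x - y)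
  rw [h0, dotProduct_zero] at h1
  have hc : 0 < (1 - w) * (1 - 2 * w) := by apply mul_pos <;> linarith
  have h2 : ∑ i, (x - y) i ^ 2 = 0 :=
    le_antisymm (by nlinarith) (Finset.sum_nonneg fun i _ => sq_nonneg _)
  rw [Finset.sum_eq_zero_iff_of_nonneg fun i _ => sq_nonneg _] at h2
  funext i
  have := pow_eq_zero_iff (two_ne_zero) |>.1 (h2 i (Finset.mem_univ i))
  simpa [sub_eq_zero] using this

end Theta

/-! ### Diagonal and Frobenius norm of P_θ. -/

section ThetaDesign

variable {n p m : ℕ} (X : Matrix (Fin n) (Fin p) ℝ) (C : Matrix (Fin m) (Fin p) ℝ) {w : ℝ}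

theorem barP0_diag_ge (hd : ∀ i, projP0 X C i i ≤ w) (i : Fin n) : 1 - w ≤ barP0 X C i i := by
  have := hd i
  simp only [barP0, Matrix.sub_apply, Matrix.one_apply_eq]
  linarith

theorem hadamard_mulVec_theta (hX : X.rank = p) (hC : C.rank = m) (hw : w < 1 / 2)
    (hd : ∀ i, projP0 X C i i ≤ w) :
    (barP0 X C ⊙ barP0 X C) *ᵥ theta X C = (projP X C).diag := by
  rw [theta, Matrix.mulVec_mulVec, Matrix.mul_nonsing_inv _ (isUnit_det_hadamard
    (barP0_transpose X C) (barP0_mul_self X C hX hC) hw (barP0_diag_ge X C hd)), Matrix.one_mulVec]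

theorem barP0_diagonal_barP0_apply (t : Fin n → ℝ) (i j : Fin n) :
    (barP0 X C * Matrix.diagonal t * barP0 X C) i j =
      ∑ k, barP0 X C i k * t k * barP0 X C j k := by
  rw [Matrix.mul_apply]
  refine Finset.sum_congr rfl fun k _ => ?_
  rw [Matrix.mul_diagonal]
  conv_lhs => rw [← barP0_transpose X C, Matrix.transpose_apply, Matrix.transpose_apply]
  conv_rhs => rw [← barP0_transpose X C, Matrix.transpose_apply, Matrix.transpose_apply]
  conv_rhs => rw [← Matrix.transpose_apply (barP0 X C) j k, barP0_transpose X C]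

/-- By symmetry of Q = `barP0`, the i-th diagonal entry of Q diag(θ) Q is ((Q∘Q)θ)_i, which the
equation for θ sets equal to P_ii. -/
theorem Ptheta_diag (hX : X.rank = p) (hC : C.rank = m) (hw : w < 1 / 2)
    (hd : ∀ i, projP0 X C i i ≤ w) (i : Fin n) : Ptheta X C i i = 0 := by
  have h := congrFun (hadamard_mulVec_theta X C hX hC hw hd) i
  rw [Ptheta, Matrix.sub_apply, barP0_diagonal_barP0_apply, sub_eq_zero]
  rw [Matrix.diag_apply] at h
  rw [← h, Matrix.mulVec, dotProduct]
  exact Finset.sum_congr rfl fun k _ => by rw [Matrix.hadamard_apply]; ring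

/-- `|P_θ|_F² = m - ∑ θᵢ Pᵢᵢ`. -/
theorem frobSq_Ptheta (hX : X.rank = p) (hC : C.rank = m) (hw : w < 1 / 2)
    (hd : ∀ i, projP0 X C i i ≤ w) :
    frobSq (Ptheta X C) = m - theta X C ⬝ᵥ (projP X C).diag := by
  set D := Matrix.diagonal (theta X C)
  set Q := barP0 X C with hQdef
  set P := projP X C with hPdef
  have hPQ : P * Q = P := projP_mul_barP0 X C hX hC
  have hQP : Q * P = P := by
    have := congrArg Matrix.transpose hPQ
    rwa [Matrix.transpose_mul, barP0_transpose, projP_transpose] at this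
  have hQQ : Q * Q = Q := barP0_mul_self X C hX hC
  have hPP : P * P = P := projP_mul_self X C hX hC
  have hPD : (P * D).trace = theta X C ⬝ᵥ P.diag := by
    rw [Matrix.trace, dotProduct]
    exact Finset.sum_congr rfl fun i _ => by
      rw [Matrix.diag_apply, Matrix.mul_diagonal, Matrix.diag_apply, mul_comm]
  -- This trace is θᵀ(Q∘Q)θ, so the equation for θ makes the quadratic term equal to each cross
  -- term; in the expansion of |P_θ|_F² one of the two cross terms then cancels.
  have hQD : (Q * D * Q * D).trace = theta X C ⬝ᵥ P.diag := by
    rw [← hadamard_mulVec_theta X C hX hC hw hd, Matrix.trace, dotProduct]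
    refine Finset.sum_congr rfl fun i _ => ?_
    rw [Matrix.diag_apply, Matrix.mul_diagonal, barP0_diagonal_barP0_apply, mul_comm,
      Matrix.mulVec, dotProduct]
    congr 1
    exact Finset.sum_congr rfl fun k _ => by rw [Matrix.hadamard_apply]; ring
  have key : (Ptheta X C)ᵀ * Ptheta X C = P - P * D * Q - Q * D * P + Q * D * (Q * D * Q) := by
    rw [Ptheta_transpose, Ptheta]
    change (P - Q * D * Q) * (P - Q * D * Q) = _
    rw [Matrix.sub_mul, Matrix.mul_sub, Matrix.mul_sub, hPP]
    have a1 : P * (Q * D * Q) = P * D * Q := by rw [← Matrix.mul_assoc, ← Matrix.mul_assoc, hPQ]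
    have a2 : Q * D * Q * P = Q * D * P := by rw [Matrix.mul_assoc, hQP]
    have a3 : Q * D * Q * (Q * D * Q) = Q * D * (Q * D * Q) := by
      rw [Matrix.mul_assoc (Q * D) Q, ← Matrix.mul_assoc Q (Q * D) Q, ← Matrix.mul_assoc Q Q D, hQQ]
    rw [a1, a2, a3]
    abel
  have t1 : (P * D * Q).trace = theta X C ⬝ᵥ P.diag := by
    rw [Matrix.trace_mul_comm, ← Matrix.mul_assoc, hQP, hPD]
  have t2 : (Q * D * P).trace = theta X C ⬝ᵥ P.diag := by
    rw [Matrix.trace_mul_comm, ← Matrix.mul_assoc, hPQ, hPD]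
  have t3 : (Q * D * (Q * D * Q)).trace = theta X C ⬝ᵥ P.diag := by
    rw [← hQD, Matrix.trace_mul_comm]
    calc _ = (Q * D * (Q * Q) * D).trace := by simp only [Matrix.mul_assoc]
      _ = _ := by rw [hQQ]
  rw [frobSq_eq_trace, key, Matrix.trace_add, Matrix.trace_sub, Matrix.trace_sub, t1, t2, t3,
    trace_projP X C hX hC]
  ring

/-- With s = θ·diag P = θᵀ(Q∘Q)θ, positive definiteness gives c|θ|² ≤ s. Young's inequality 2s ≤
c|θ|² + c⁻¹ ∑ P_ii² then lets one copy of s be absorbed. -/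
theorem theta_dotProduct_le (hX : X.rank = p) (hC : C.rank = m) (hw : w < 1 / 2)
    (hd : ∀ i, projP0 X C i i ≤ w) :
    theta X C ⬝ᵥ (projP X C).diag ≤ (∑ i, projP X C i i ^ 2) / ((1 - w) * (1 - 2 * w)) := by
  have hc : 0 < (1 - w) * (1 - 2 * w) := by apply mul_pos <;> linarith
  have h1 := sum_sq_le_hadamard_form (barP0_transpose X C) (barP0_mul_self X C hX hC) hw
    (barP0_diag_ge X C hd) (theta X C)
  rw [hadamard_mulVec_theta X C hX hC hw hd] at h1
  set c := (1 - w) * (1 - 2 * w)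
  have h2 : 2 * (theta X C ⬝ᵥ (projP X C).diag) ≤
      c * ∑ i, theta X C i ^ 2 + (∑ i, projP X C i i ^ 2) / c := by
    rw [dotProduct, Finset.mul_sum, Finset.mul_sum, Finset.sum_div, ← Finset.sum_add_distrib]
    refine Finset.sum_le_sum fun i _ => ?_
    rw [Matrix.diag_apply]
    have : 0 ≤ (c * theta X C i - projP X C i i) ^ 2 / c := by positivity
    have e : (c * theta X C i - projP X C i i) ^ 2 / c =
      c * theta X C i ^ 2 + projP X C i i ^ 2 / c - 2 * (theta X C i * projP X C i i) := by
      field_simp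
      ring
    linarith
  linarith

end ThetaDesign

/-! ### Taylor expansions with remainder of fractional order. -/

section Taylor

/-- Mean value inequality for s ↦ f(r+sy) - f'(r)sy - c(sy)²/2 on [0,1]. The number c is free: c = 0
gives a first-order expansion and c = f''(r) a second-order one. -/
theorem abs_sub_taylor_le {f f' : ℝ → ℝ} (hf : ∀ x, HasDerivAt f (f' x) x) {r y c L : ℝ}
    (h : ∀ s ∈ Set.Icc (0 : ℝ) 1, |f' (r + s * y) - f' r - c * (s * y)| ≤ L) :
    |f (r + y) - f r - f' r * y - c * y ^ 2 / 2| ≤ L * |y| := by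
  have hd : ∀ s ∈ Set.Icc (0 : ℝ) 1, HasDerivWithinAt
      (fun s => f (r + s * y) - f' r * (s * y) - c * (s * y) ^ 2 / 2)
      ((f' (r + s * y) - f' r - c * (s * y)) * y) (Set.Icc 0 1) s := by
    intro s _
    have h1 : HasDerivAt (fun s : ℝ => s * y) y s := by simpa using (hasDerivAt_id s).mul_const y
    have h2 : HasDerivAt (fun s : ℝ => f (r + s * y)) (f' (r + s * y) * y) s :=
      (hf (r + s * y)).comp s (h1.const_add r)
    have h3 := (h2.sub (h1.const_mul (f' r))).sub (((h1.pow 2).const_mul c).div_const 2)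
    refine (HasDerivAt.congr_deriv h3 ?_).hasDerivWithinAt
    norm_num
    ring
  have := (convex_Icc (0 : ℝ) 1).norm_image_sub_le_of_norm_hasDerivWithin_le (C := L * |y|) hd
    (fun s hs => by
      rw [norm_mul, Real.norm_eq_abs, Real.norm_eq_abs]
      exact mul_le_mul_of_nonneg_right (h s hs) (abs_nonneg y))
    (Set.left_mem_Icc.2 zero_le_one) (Set.right_mem_Icc.2 zero_le_one)
  simp only [Real.norm_eq_abs, one_mul, zero_mul, add_zero, mul_zero, sub_zero, abs_one,
    mul_one] at this
  convert this using 2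
  ring

/-- Controls the increments of the derivative of |x|^q, with s = q - 2. For |v| ≤ |u| the weighted
mean inequality |u|^s |v|^(1-s) ≤ s|u| + (1-s)|v| replaces differentiation, which would break down
at zero. -/
theorem abs_rpow_mul_sub_le {s : ℝ} (hs : 0 < s) (hs1 : s ≤ 1) (u v : ℝ) :
    |(|u| ^ s * u - |v| ^ s * v)| ≤ (|u| ^ s + |v| ^ s) * |u - v| := by
  wlog huv : |v| ≤ |u| generalizing u v
  · have := this v u (le_of_not_ge huv)
    rw [abs_sub_comm, abs_sub_comm u v, add_comm (|u| ^ s)]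
    exact this
  have h1 : |v| * (|u| ^ s - |v| ^ s) ≤ |v| ^ s * |u - v| := by
    have h2 : |u| ^ s * |v| ^ (1 - s) ≤ s * |u| + (1 - s) * |v| :=
      Real.geom_mean_le_arith_mean2_weighted hs.le (by linarith) (abs_nonneg _) (abs_nonneg _)
        (by ring)
    have h3 : |v| ^ (1 - s) * |v| ^ s = |v| := by
      rw [← Real.rpow_add_of_nonneg (abs_nonneg v) (by linarith) hs.le]
      simp
    have h4 : |u| ^ s * |v| ≤ |v| ^ s * (s * |u| + (1 - s) * |v|) := by
      calc |u| ^ s * |v| = |v| ^ s * (|u| ^ s * |v| ^ (1 - s)) := by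
            conv_lhs => rw [← h3]
            ring
        _ ≤ _ := mul_le_mul_of_nonneg_left h2 (by positivity)
    have h5 : |u| - |v| ≤ |u - v| := abs_sub_abs_le_abs_sub u v
    have h6 : 0 ≤ |v| ^ s := by positivity
    have h7 : s * (|u| - |v|) ≤ |u - v| := by nlinarith [abs_nonneg (u - v)]
    nlinarith [mul_le_mul_of_nonneg_left h7 h6]
  have h8 : |v| ^ s ≤ |u| ^ s := Real.rpow_le_rpow (abs_nonneg v) huv hs.le
  calc |(|u| ^ s * u - |v| ^ s * v)| = |(|u| ^ s * (u - v) + v * (|u| ^ s - |v| ^ s))| := by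
        congr 1; ring
    _ ≤ |(|u| ^ s * (u - v))| + |v * (|u| ^ s - |v| ^ s)| := abs_add_le _ _
    _ = |u| ^ s * |u - v| + |v| * (|u| ^ s - |v| ^ s) := by
        rw [abs_mul, abs_mul, abs_of_nonneg (by positivity : 0 ≤ |u| ^ s),
          abs_of_nonneg (sub_nonneg.2 h8)]
    _ ≤ _ := by linarith

/-- First-order expansion of |·|^q. Subadditivity of t^(q-2), valid as q ≤ 3, splits the power of a
+ sb; the constant 6 bounds 2q. -/
theorem abs_abs_rpow_add_sub_le {q : ℝ} (hq : 2 < q) (hq3 : q ≤ 3) (a b : ℝ) :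
    |(|a + b| ^ q - |a| ^ q - q * |a| ^ (q - 2) * a * b)| ≤
      6 * (|a| ^ (q - 2) * b ^ 2 + |b| ^ q) := by
  have hf : ∀ x : ℝ, HasDerivAt (fun x : ℝ => |x| ^ q) (q * |x| ^ (q - 2) * x) x := fun x =>
    hasDerivAt_abs_rpow x (by linarith)
  have hb : |b| ^ (q - 2) * b ^ 2 = |b| ^ q := by
    rw [← sq_abs b, ← Real.rpow_natCast, ← Real.rpow_add_of_nonneg (abs_nonneg b) (by linarith)
      (by norm_num)]
    norm_num
  have key := abs_sub_taylor_le hf (r := a) (y := b) (c := 0)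
    (L := q * (2 * |a| ^ (q - 2) + |b| ^ (q - 2)) * |b|) (by
      intro s hs
      have hsb : |s * b| ≤ |b| := by
        rw [abs_mul, abs_of_nonneg hs.1]
        nlinarith [hs.2, abs_nonneg b]
      have e : q * |a + s * b| ^ (q - 2) * (a + s * b) - q * |a| ^ (q - 2) * a - 0 * (s * b) =
          q * (|a + s * b| ^ (q - 2) * (a + s * b) - |a| ^ (q - 2) * a) := by ring
      rw [e, abs_mul, abs_of_pos (by linarith : 0 < q), mul_assoc]
      refine mul_le_mul_of_nonneg_left ?_ (by linarith)
      refine (abs_rpow_mul_sub_le (by linarith) (by linarith) _ _).trans ?_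
      have h1 : |a + s * b| ^ (q - 2) ≤ |a| ^ (q - 2) + |b| ^ (q - 2) :=
        (Real.rpow_le_rpow (abs_nonneg _) ((abs_add_le _ _).trans (by linarith))
          (by linarith)).trans (Real.rpow_add_le_add_rpow (abs_nonneg a) (abs_nonneg b)
            (by linarith) (by linarith))
      have h2 : |a + s * b - a| ≤ |b| := by simpa using hsb
      refine mul_le_mul (by linarith) h2 (abs_nonneg _) (by positivity))
  have e : q * (2 * |a| ^ (q - 2) + |b| ^ (q - 2)) * |b| * |b| =
      q * (2 * (|a| ^ (q - 2) * b ^ 2) + |b| ^ q) := by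
    rw [← hb, ← sq_abs b]; ring
  rw [e] at key
  simp only [zero_mul, zero_div, sub_zero] at key
  refine key.trans ?_
  have h3 : 0 ≤ |a| ^ (q - 2) * b ^ 2 := by positivity
  have h4 : 0 ≤ |b| ^ q := by positivity
  nlinarith

/-- A smooth version of the indicator function of the negative half-line, with a quadratic
Taylor expansion whose error is of order `|y| ^ q` for all `2 ≤ q ≤ 3`. -/
theorem exists_smooth_cutoff : ∃ (χ χ' χ'' : ℝ → ℝ) (M : ℝ), 0 < M ∧ Continuous χ ∧
    (∀ x, 0 ≤ χ x) ∧ (∀ x, χ x ≤ 1) ∧ (∀ x ≤ 0, χ x = 1) ∧ (∀ x, 1 ≤ x → χ x = 0) ∧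
    ∀ q : ℝ, 2 < q → q ≤ 3 → ∀ r y : ℝ,
      |χ (r + y) - χ r - χ' r * y - χ'' r * y ^ 2 / 2| ≤ M * |y| ^ q := by
  set g : ℝ → ℝ := fun x => 1 - Real.smoothTransition x with hg
  have hgs : ContDiff ℝ 3 g := contDiff_const.sub Real.smoothTransition.contDiff
  have hg1 : ContDiff ℝ 2 (deriv g) := hgs.deriv' (n := 2)
  have hg2 : ContDiff ℝ 1 (deriv (deriv g)) := hg1.deriv' (n := 1)
  have hg3 : ContDiff ℝ 0 (deriv (deriv (deriv g))) := hg2.deriv' (n := 0)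
  have hs1 : HasCompactSupport (deriv g) := by
    refine HasCompactSupport.intro (isCompact_Icc (a := (0 : ℝ)) (b := 1)) fun x hx => ?_
    rw [Set.mem_Icc, not_and_or, not_le, not_le] at hx
    rcases hx with hx | hx
    · have : g =ᶠ[𝓝 x] fun _ => 1 := by
        filter_upwards [Iio_mem_nhds hx] with t ht
        simp [hg, Real.smoothTransition.zero_of_nonpos (le_of_lt ht)]
      rw [this.deriv_eq, deriv_const]
    · have : g =ᶠ[𝓝 x] fun _ => 0 := by
        filter_upwards [Ioi_mem_nhds hx] with t ht
        simp [hg, Real.smoothTransition.one_of_one_le (le_of_lt ht)]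
      rw [this.deriv_eq, deriv_const]
  obtain ⟨M2, hM2⟩ := hs1.deriv.exists_bound_of_continuous hg2.continuous
  obtain ⟨M3, hM3⟩ := hs1.deriv.deriv.exists_bound_of_continuous hg3.continuous
  -- 2 * M2 bounds the oscillation of the second derivative and M3 its Lipschitz constant; both are
  -- needed so that a single constant serves all q.
  set M := max (2 * M2) M3 + 1 with hMdef
  have h20 : 0 ≤ M2 := (norm_nonneg _).trans (hM2 0)
  have hM : 0 < M := by
    have : 2 * M2 ≤ max (2 * M2) M3 := le_max_left _ _
    linarith
  have hd0 : ∀ x, HasDerivAt g (deriv g x) x := fun x =>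
    (hgs.differentiable (by norm_num) x).hasDerivAt
  have hd1 : ∀ x, HasDerivAt (deriv g) (deriv (deriv g) x) x := fun x =>
    (hg1.differentiable (by norm_num) x).hasDerivAt
  have hlip : ∀ u v, |deriv (deriv g) u - deriv (deriv g) v| ≤ M * |u - v| := by
    intro u v
    have := Convex.norm_image_sub_le_of_norm_deriv_le (f := deriv (deriv g)) (C := M)
      (s := Set.univ) (x := v) (y := u) (fun x _ => hg2.differentiable (by norm_num) x)
      (fun x _ => (hM3 x).trans ((le_max_right (2 * M2) M3).trans (by linarith)))
      convex_univ trivial trivial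
    simpa [Real.norm_eq_abs] using this
  have hbd : ∀ u v, |deriv (deriv g) u - deriv (deriv g) v| ≤ M := by
    intro u v
    have h1 := hM2 u
    have h2 := hM2 v
    rw [Real.norm_eq_abs] at h1 h2
    have := abs_sub (deriv (deriv g) u) (deriv (deriv g) v)
    have h4 : 2 * M2 ≤ max (2 * M2) M3 := le_max_left _ _
    linarith
  have hexp : ∀ L r y : ℝ, (∀ s ∈ Set.Icc (0 : ℝ) 1,
      |deriv (deriv g) (r + s * y) - deriv (deriv g) r| ≤ L) →
      |g (r + y) - g r - deriv g r * y - deriv (deriv g) r * y ^ 2 / 2| ≤ L * y ^ 2 := by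
    intro L r y hL
    have hL0 : 0 ≤ L := (abs_nonneg _).trans (hL 0 (Set.left_mem_Icc.2 zero_le_one))
    have := abs_sub_taylor_le hd0 (r := r) (y := y) (c := deriv (deriv g) r) (L := L * |y|) (by
      intro s hs
      have hsy : |s * y| ≤ |y| := by
        rw [abs_mul, abs_of_nonneg hs.1]
        nlinarith [hs.2, abs_nonneg y]
      have h1 : ∀ t ∈ Set.Icc (0 : ℝ) 1, HasDerivWithinAt
          (fun t => deriv g (r + t * (s * y)) - deriv (deriv g) r * (t * (s * y)))
          ((deriv (deriv g) (r + t * (s * y)) - deriv (deriv g) r) * (s * y)) (Set.Icc 0 1) t := by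
        intro t _
        have h1 : HasDerivAt (fun t : ℝ => t * (s * y)) (s * y) t := by
          simpa using (hasDerivAt_id t).mul_const (s * y)
        have h2 : HasDerivAt (fun t : ℝ => deriv g (r + t * (s * y)))
            (deriv (deriv g) (r + t * (s * y)) * (s * y)) t :=
          (hd1 _).comp t (h1.const_add r)
        refine ((h2.sub (h1.const_mul (deriv (deriv g) r))).congr_deriv ?_).hasDerivWithinAt
        ring
      have h2 := (convex_Icc (0 : ℝ) 1).norm_image_sub_le_of_norm_hasDerivWithin_le
        (C := L * |y|) h1 (fun t ht => by
          rw [norm_mul, Real.norm_eq_abs, Real.norm_eq_abs]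
          refine mul_le_mul ?_ hsy (abs_nonneg _) hL0
          have := hL (t * s) ⟨mul_nonneg ht.1 hs.1, mul_le_one₀ ht.2 hs.1 hs.2⟩
          rwa [mul_assoc] at this)
        (Set.left_mem_Icc.2 zero_le_one) (Set.right_mem_Icc.2 zero_le_one)
      simp only [Real.norm_eq_abs, one_mul, zero_mul, add_zero, mul_zero, sub_zero, abs_one,
        mul_one] at h2
      convert h2 using 2
      ring)
    rwa [mul_assoc, ← sq, sq_abs] at this
  refine ⟨g, deriv g, deriv (deriv g), M, hM, hgs.continuous, fun x => ?_, fun x => ?_,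
    fun x hx => ?_, fun x hx => ?_, fun q hq hq3 r y => ?_⟩
  · simpa [hg] using Real.smoothTransition.le_one x
  · simpa [hg] using Real.smoothTransition.nonneg x
  · simp [hg, Real.smoothTransition.zero_of_nonpos hx]
  · simp [hg, Real.smoothTransition.one_of_one_le hx]
  -- For |y| ≤ 1 the Lipschitz bound gives an error M|y|³, for |y| ≥ 1 boundedness gives M|y|²; each
  -- is at most M|y|^q.
  · rcases le_total |y| 1 with hy | hy
    · refine (hexp (M * |y|) r y fun s hs => (hlip _ _).trans ?_).trans ?_
      · have : |r + s * y - r| ≤ |y| := by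
          rw [add_sub_cancel_left, abs_mul, abs_of_nonneg hs.1]
          nlinarith [hs.2, abs_nonneg y]
        exact mul_le_mul_of_nonneg_left this hM.le
      · rw [← sq_abs, mul_assoc]
        refine mul_le_mul_of_nonneg_left ?_ hM.le
        have : |y| * |y| ^ 2 = |y| ^ (3 : ℝ) := by
          rw [show (3 : ℝ) = ((3 : ℕ) : ℝ) by norm_num, Real.rpow_natCast]; ring
        rw [this]
        rcases (abs_nonneg y).eq_or_lt with h0 | h0
        · rw [← h0, Real.zero_rpow (by norm_num), Real.zero_rpow (by linarith)]
        · exact Real.rpow_le_rpow_of_exponent_ge h0 hy hq3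
    · refine (hexp M r y fun s _ => hbd _ _).trans (mul_le_mul_of_nonneg_left ?_ hM.le)
      rw [← sq_abs, ← Real.rpow_natCast]
      exact Real.rpow_le_rpow_of_exponent_le hy (by simpa using hq.le)

end Taylor

/-! ### Rosenthal's inequality for 2 < q ≤ 3. -/

section Rosenthal

variable {Ω : Type*} [MeasurableSpace Ω] {μ : Measure Ω} {q : ℝ}

theorem memLp_of_integrable_abs_rpow {S : Ω → ℝ} (hS : Measurable S) (hq : 0 < q)
    (h : Integrable (fun ω => |S ω| ^ q) μ) : MemLp S (ENNReal.ofReal q) μ := by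
  rw [← integrable_norm_rpow_iff hS.aestronglyMeasurable (by simp [hq]) (by simp),
    ENNReal.toReal_ofReal hq.le]
  exact h

theorem integrable_abs_rpow_of_memLp {S : Ω → ℝ} (hq : 0 < q)
    (h : MemLp S (ENNReal.ofReal q) μ) : Integrable (fun ω => |S ω| ^ q) μ := by
  have := h.integrable_norm_rpow (by simp [hq]) (by simp)
  rwa [ENNReal.toReal_ofReal hq.le] at this

variable [IsProbabilityMeasure μ]

theorem integral_abs_rpow_le_rpow_integral_sq {S : Ω → ℝ} (hS : MemLp S 2 μ) {s : ℝ}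
    (hs : 0 ≤ s) (hs1 : s ≤ 1) : ∫ ω, |S ω| ^ s ∂μ ≤ (∫ ω, S ω ^ 2 ∂μ) ^ (s / 2) := by
  have e : ∀ ω, |S ω| ^ s = (S ω ^ 2) ^ (s / 2) := fun ω => by
    rw [← sq_abs, ← Real.rpow_natCast, ← Real.rpow_mul (abs_nonneg _)]
    congr 1
    push_cast
    ring
  have hint : Integrable (fun ω => |S ω| ^ s) μ := by
    have h := integrable_norm_rpow_of_le (f := S) (p := s) (q := 2) hS.1 hs (by norm_num)
      (by linarith) (by simpa using hS.integrable_sq)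
    simpa using h
  simp_rw [e] at hint ⊢
  exact ConcaveOn.le_map_integral (Real.concaveOn_rpow (by linarith) (by linarith))
    (Real.continuous_rpow_const (by linarith)).continuousOn isClosed_Ici
    (Eventually.of_forall fun ω => sq_nonneg (S ω)) hS.integrable_sq hint

theorem memLp_two_of_integrable_abs_rpow {S : Ω → ℝ} (hS : Measurable S) (hq : 2 < q)
    (h : Integrable (fun ω => |S ω| ^ q) μ) : MemLp S 2 μ := by
  refine (memLp_of_integrable_abs_rpow hS (by linarith) h).mono_exponent ?_
  rw [← ENNReal.ofReal_ofNat]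
  exact ENNReal.ofReal_le_ofReal hq.le

/-- Integrate the expansion of |S + ξ|^q: independence and centring remove the linear term and
factor the next one, and Jensen bounds 𝔼|S|^(q-2) by a power of 𝔼S². -/
theorem integral_abs_rpow_add_le (hq : 2 < q) (hq3 : q ≤ 3) {S ξ : Ω → ℝ} (hind : IndepFun S ξ μ)
    (hSm : Measurable S) (hξm : Measurable ξ) (hS : Integrable (fun ω => |S ω| ^ q) μ)
    (hξ : Integrable (fun ω => |ξ ω| ^ q) μ) (h0 : ∫ ω, ξ ω ∂μ = 0) :
    ∫ ω, |S ω + ξ ω| ^ q ∂μ ≤ ∫ ω, |S ω| ^ q ∂μ +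
      6 * ((∫ ω, S ω ^ 2 ∂μ) ^ ((q - 2) / 2) * ∫ ω, ξ ω ^ 2 ∂μ + ∫ ω, |ξ ω| ^ q ∂μ) := by
  have hS2 := memLp_two_of_integrable_abs_rpow hSm hq hS
  have hξ2 := memLp_two_of_integrable_abs_rpow hξm hq hξ
  have hsum : Integrable (fun ω => |S ω + ξ ω| ^ q) μ :=
    integrable_abs_rpow_of_memLp (by linarith)
      ((memLp_of_integrable_abs_rpow hSm (by linarith) hS).add
        (memLp_of_integrable_abs_rpow hξm (by linarith) hξ))
  have hSq2 : Integrable (fun ω => |S ω| ^ (q - 2)) μ :=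
    integrable_norm_rpow_of_le (f := S) (p := q - 2) (q := q) hSm.aestronglyMeasurable
      (by linarith) (by linarith) (by linarith) hS
  have hm1 : Measurable fun t : ℝ => |t| ^ (q - 2) := by fun_prop
  have hm2 : Measurable fun t : ℝ => q * |t| ^ (q - 2) * t := by fun_prop
  have hSq1 : Integrable (fun ω => q * |S ω| ^ (q - 2) * S ω) μ := by
    have h1 : Integrable (fun ω => |S ω| ^ (q - 1)) μ :=
      integrable_norm_rpow_of_le (f := S) (p := q - 1) (q := q) hSm.aestronglyMeasurable
        (by linarith) (by linarith) (by linarith) hS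
    refine (h1.const_mul q).mono (hm2.comp hSm).aestronglyMeasurable
      (Eventually.of_forall fun ω => ?_)
    have : |S ω| ^ (q - 1) = |S ω| ^ (q - 2) * |S ω| := by
      rw [← Real.rpow_add_one' (abs_nonneg _) (by linarith)]
      congr 1; ring
    simp only [this, norm_mul, Real.norm_eq_abs, abs_abs, mul_assoc, le_refl]
  have hmain : ∫ ω, q * |S ω| ^ (q - 2) * S ω * ξ ω ∂μ = 0 := by
    refine ((hind.comp hm2 measurable_id).integral_fun_mul_eq_mul_integral
      (hm2.comp hSm).aestronglyMeasurable hξm.aestronglyMeasurable).trans ?_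
    simp [h0]
  have hprod : Integrable (fun ω => q * |S ω| ^ (q - 2) * S ω * ξ ω) μ :=
    (hind.comp hm2 measurable_id).integrable_mul hSq1 (hξ2.integrable (by norm_num))
  have hm3 : Measurable fun t : ℝ => t ^ 2 := by fun_prop
  have hprod2 : Integrable (fun ω => |S ω| ^ (q - 2) * ξ ω ^ 2) μ :=
    (hind.comp hm1 hm3).integrable_mul hSq2 hξ2.integrable_sq
  have hmain2 : ∫ ω, |S ω| ^ (q - 2) * ξ ω ^ 2 ∂μ =
      (∫ ω, |S ω| ^ (q - 2) ∂μ) * ∫ ω, ξ ω ^ 2 ∂μ :=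
    (hind.comp hm1 hm3).integral_fun_mul_eq_mul_integral
      (hm1.comp hSm).aestronglyMeasurable (hm3.comp hξm).aestronglyMeasurable
  have hadd : Integrable (fun ω => |S ω| ^ q + q * |S ω| ^ (q - 2) * S ω * ξ ω) μ := hS.add hprod
  have hadd2 : Integrable (fun ω => 6 * (|S ω| ^ (q - 2) * ξ ω ^ 2 + |ξ ω| ^ q)) μ :=
    (hprod2.add hξ).const_mul 6
  calc ∫ ω, |S ω + ξ ω| ^ q ∂μ
      ≤ ∫ ω, (|S ω| ^ q + q * |S ω| ^ (q - 2) * S ω * ξ ω +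
          6 * (|S ω| ^ (q - 2) * ξ ω ^ 2 + |ξ ω| ^ q)) ∂μ := by
        refine integral_mono hsum (hadd.add hadd2) fun ω => ?_
        have := (abs_le.1 (abs_abs_rpow_add_sub_le hq hq3 (S ω) (ξ ω))).2
        dsimp only
        linarith
    _ = ∫ ω, |S ω| ^ q ∂μ +
      6 * ((∫ ω, |S ω| ^ (q - 2) ∂μ) * ∫ ω, ξ ω ^ 2 ∂μ + ∫ ω, |ξ ω| ^ q ∂μ) := by
        rw [integral_add hadd hadd2, integral_add hS hprod,
          hmain, integral_const_mul, integral_add hprod2 hξ, hmain2, add_zero]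
    _ ≤ _ := by
        have h1 := integral_abs_rpow_le_rpow_integral_sq hS2 (s := q - 2) (by linarith)
          (by linarith)
        have h2 : 0 ≤ ∫ ω, ξ ω ^ 2 ∂μ := integral_nonneg fun ω => sq_nonneg _
        have := mul_le_mul_of_nonneg_right h1 h2
        linarith

theorem integral_abs_rpow_sum_le (hq : 2 < q) (hq3 : q ≤ 3) {ι : Type*} {ξ : ι → Ω → ℝ}
    (hind : iIndepFun ξ μ) (hm : ∀ j, Measurable (ξ j))
    (hξ : ∀ j, Integrable (fun ω => |ξ j ω| ^ q) μ) (h0 : ∀ j, ∫ ω, ξ j ω ∂μ = 0)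
    (s : Finset ι) : ∫ ω, |∑ j ∈ s, ξ j ω| ^ q ∂μ ≤
      6 * (∑ j ∈ s, ∫ ω, |ξ j ω| ^ q ∂μ + (∑ j ∈ s, ∫ ω, ξ j ω ^ 2 ∂μ) ^ (q / 2)) := by
  classical
  have hnn : ∀ j, 0 ≤ ∫ ω, ξ j ω ^ 2 ∂μ := fun j => integral_nonneg fun ω => sq_nonneg _
  have hLp : ∀ t : Finset ι, MemLp (fun ω => ∑ j ∈ t, ξ j ω) (ENNReal.ofReal q) μ := fun t =>
    memLp_finsetSum t fun j _ => memLp_of_integrable_abs_rpow (hm j) (by linarith) (hξ j)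
  have h2 : ∀ j, MemLp (ξ j) 2 μ := fun j => memLp_two_of_integrable_abs_rpow (hm j) hq (hξ j)
  have hsq : ∀ t : Finset ι, ∫ ω, (∑ j ∈ t, ξ j ω) ^ 2 ∂μ = ∑ j ∈ t, ∫ ω, ξ j ω ^ 2 ∂μ := by
    intro t
    have hv := IndepFun.variance_sum (s := t) (fun j _ => h2 j)
      (fun i _ j _ hij => hind.indepFun hij)
    have hz : ∫ ω, (∑ j ∈ t, ξ j) ω ∂μ = 0 := by
      simp only [Finset.sum_apply]
      rw [integral_finsetSum _ fun j _ => (h2 j).integrable (by norm_num)]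
      exact Finset.sum_eq_zero fun j _ => h0 j
    rw [variance_of_integral_eq_zero (Finset.aemeasurable_sum t fun j _ => (hm j).aemeasurable)
      hz] at hv
    simp only [Finset.sum_apply] at hv
    rw [hv]
    exact Finset.sum_congr rfl fun j _ =>
      variance_of_integral_eq_zero (hm j).aemeasurable (h0 j)
  set B := ∑ j ∈ s, ∫ ω, ξ j ω ^ 2 ∂μ with hB
  have hB0 : 0 ≤ B := Finset.sum_nonneg fun j _ => hnn j
  -- The variance of every partial sum is replaced by the total variance B, which makes the
  -- increments additive in t; at t = s the factors recombine to B^(q/2).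
  have key : ∀ t : Finset ι, t ⊆ s → ∫ ω, |∑ j ∈ t, ξ j ω| ^ q ∂μ ≤
      6 * (∑ j ∈ t, ∫ ω, |ξ j ω| ^ q ∂μ + B ^ ((q - 2) / 2) * ∑ j ∈ t, ∫ ω, ξ j ω ^ 2 ∂μ) := by
    intro t
    induction t using Finset.induction_on with
    | empty => intro _; simp [Real.zero_rpow (by linarith : q ≠ 0)]
    | insert a t ha ih =>
      intro hts
      have hts' : t ⊆ s := (Finset.subset_insert a t).trans hts
      have hi : IndepFun (fun ω => ∑ j ∈ t, ξ j ω) (ξ a) μ := by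
        have := hind.indepFun_finsetSum_of_notMem hm ha
        convert this using 1
        funext ω
        simp
      have h1 := integral_abs_rpow_add_le hq hq3 hi (Finset.measurable_sum t fun j _ => hm j)
        (hm a) (integrable_abs_rpow_of_memLp (by linarith) (hLp t)) (hξ a) (h0 a)
      rw [hsq] at h1
      have h3 : (∑ j ∈ t, ∫ ω, ξ j ω ^ 2 ∂μ) ^ ((q - 2) / 2) ≤ B ^ ((q - 2) / 2) :=
        Real.rpow_le_rpow (Finset.sum_nonneg fun j _ => hnn j)
          (Finset.sum_le_sum_of_subset_of_nonneg hts' fun j _ _ => hnn j) (by linarith)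
      have h4 := mul_le_mul_of_nonneg_right h3 (hnn a)
      have h5 := ih hts'
      simp only [Finset.sum_insert ha]
      have e : ∀ ω, ξ a ω + ∑ j ∈ t, ξ j ω = ∑ j ∈ t, ξ j ω + ξ a ω := fun ω => add_comm _ _
      simp only [e]
      nlinarith
  refine (key s subset_rfl).trans_eq ?_
  rw [← hB, ← Real.rpow_add_one' hB0 (by linarith)]
  congr 3
  ring

/-- Rosenthal's inequality for exponents between two and three. -/
theorem lintegral_abs_rpow_sum_le (hq : 2 < q) (hq3 : q ≤ 3) {ι : Type*} [Fintype ι]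
    {ξ : ι → Ω → ℝ} (hind : iIndepFun ξ μ) (hm : ∀ j, Measurable (ξ j))
    (h0 : ∀ j, ∫ ω, ξ j ω ∂μ = 0) :
    ∫⁻ ω, ENNReal.ofReal (|∑ j, ξ j ω| ^ q) ∂μ ≤
      6 * (∑ j, ∫⁻ ω, ENNReal.ofReal (|ξ j ω| ^ q) ∂μ +
        ENNReal.ofReal ((∑ j, ∫ ω, ξ j ω ^ 2 ∂μ) ^ (q / 2))) := by
  by_cases hfin : ∀ j, ∫⁻ ω, ENNReal.ofReal (|ξ j ω| ^ q) ∂μ ≠ ∞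
  · have hint : ∀ j, Integrable (fun ω => |ξ j ω| ^ q) μ := fun j =>
      (lintegral_ofReal_ne_top_iff_integrable
        (by have := hm j; fun_prop : Measurable fun ω => |ξ j ω| ^ q).aestronglyMeasurable
        (Eventually.of_forall fun ω => by positivity)).1 (hfin j)
    have hLp : MemLp (fun ω => ∑ j, ξ j ω) (ENNReal.ofReal q) μ :=
      memLp_finsetSum _ fun j _ => memLp_of_integrable_abs_rpow (hm j) (by linarith) (hint j)
    have h1 := integral_abs_rpow_sum_le hq hq3 hind hm hint h0 Finset.univ
    rw [← ofReal_integral_eq_lintegral_ofReal (integrable_abs_rpow_of_memLp (by linarith) hLp)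
      (Eventually.of_forall fun ω => by positivity)]
    refine (ENNReal.ofReal_le_ofReal h1).trans_eq ?_
    have hnn : 0 ≤ ∑ j, ∫ ω, ξ j ω ^ 2 ∂μ :=
      Finset.sum_nonneg fun j _ => integral_nonneg fun ω => sq_nonneg _
    rw [ENNReal.ofReal_mul (by norm_num), ENNReal.ofReal_add
      (Finset.sum_nonneg fun j _ => integral_nonneg fun ω => by positivity) (by positivity),
      ENNReal.ofReal_sum_of_nonneg fun j _ => integral_nonneg fun ω => by positivity]
    congr 1
    · simp
    congr 1
    · exact Finset.sum_congr rfl fun j _ => ofReal_integral_eq_lintegral_ofReal (hint j)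
        (Eventually.of_forall fun ω => by positivity)
  -- If some moment is infinite, so is the right-hand side.
  · push Not at hfin
    obtain ⟨j, hj⟩ := hfin
    have : ∑ j, ∫⁻ ω, ENNReal.ofReal (|ξ j ω| ^ q) ∂μ = ∞ :=
      ENNReal.sum_eq_top.2 ⟨j, Finset.mem_univ j, hj⟩
    rw [this]
    simp

end Rosenthal

/-- The quadratic form `aᵀ Σ a` of the covariance matrix of `ν`. -/
noncomputable def covForm {d : ℕ} (ν : Measure (EuclideanSpace ℝ (Fin d)))
    (a : EuclideanSpace ℝ (Fin d)) : ℝ := a.ofLp ⬝ᵥ covMat ν *ᵥ a.ofLp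

/-- The absolute moment of order `q` of the standard normal distribution. -/
noncomputable def gaussMoment (q : ℝ) : ℝ≥0∞ :=
  ∫⁻ t, ENNReal.ofReal (|t| ^ q) ∂(gaussianReal 0 1)

theorem gaussMoment_ne_top {q : ℝ} (hq : 0 < q) : gaussMoment q ≠ ∞ := by
  have h := integrable_abs_rpow_of_memLp hq
    (memLp_id_gaussianReal' (μ := 0) (v := 1) (ENNReal.ofReal q) (by simp))
  exact (lintegral_ofReal_ne_top_iff_integrable h.1
    (Eventually.of_forall fun t => by positivity)).2 h

theorem lintegral_abs_rpow_gaussianReal {q : ℝ} (v : NNReal) :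
    ∫⁻ t, ENNReal.ofReal (|t| ^ q) ∂(gaussianReal 0 v) =
      gaussMoment q * ENNReal.ofReal ((v : ℝ) ^ (q / 2)) := by
  have hm : Measurable fun t : ℝ => ENNReal.ofReal (|t| ^ q) := by fun_prop
  have h : gaussianReal 0 v = (gaussianReal 0 1).map (√v * ·) := by
    rw [gaussianReal_map_const_mul, mul_zero, mul_one]
    congr 1
    ext
    simp
  rw [h, lintegral_map hm (by fun_prop), gaussMoment, ← lintegral_mul_const _ hm]
  refine lintegral_congr fun t => ?_
  rw [← ENNReal.ofReal_mul (by positivity), abs_mul, Real.mul_rpow (abs_nonneg _) (abs_nonneg _),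
    mul_comm]
  congr 2
  have hv : (0 : ℝ) ≤ v := v.2
  rw [abs_of_nonneg (Real.sqrt_nonneg _), Real.sqrt_eq_rpow, ← Real.rpow_mul hv]
  congr 1
  ring

/-! ### The covariance form and moments of the matching Gaussian law. -/

section Covariance

variable {d : ℕ} {ν : Measure (EuclideanSpace ℝ (Fin d))}

theorem covForm_eq_sum (a : EuclideanSpace ℝ (Fin d)) :
    covForm ν a = ∑ i, ∑ j, a i * a j * covMat ν i j := by
  simp only [covForm, dotProduct, Matrix.mulVec, Finset.mul_sum]
  exact Finset.sum_congr rfl fun i _ => Finset.sum_congr rfl fun j _ => by ring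

theorem covForm_eq_of_factor {A : Matrix (Fin d) (Fin d) ℝ} (hA : covMat ν = Aᵀ * A)
    (a : EuclideanSpace ℝ (Fin d)) :
    covForm ν a = ∑ k, inner ℝ a (WithLp.toLp 2 (A k)) ^ 2 := by
  rw [covForm, hA, ← Matrix.mulVec_mulVec, Matrix.dotProduct_mulVec, Matrix.vecMul_transpose]
  refine Finset.sum_congr rfl fun k _ => ?_
  rw [← sq]
  congr 1

theorem covMat_transpose : (covMat ν)ᵀ = covMat ν := by
  ext i j
  simp only [covMat, Matrix.transpose_apply, Matrix.of_apply]
  exact covariance_comm _ _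

/-- For Σ = AᵀA the sum is tr(AΣAᵀ) = tr(Σ²). -/
theorem sum_covForm_factor {A : Matrix (Fin d) (Fin d) ℝ} (hA : covMat ν = Aᵀ * A) :
    ∑ k, covForm ν (WithLp.toLp 2 (A k)) = varsig ν ^ 2 := by
  have h1 : ∑ k, covForm ν (WithLp.toLp 2 (A k)) = (A * covMat ν * Aᵀ).trace := by
    rw [Matrix.trace]
    refine Finset.sum_congr rfl fun k _ => ?_
    rw [Matrix.diag_apply, Matrix.mul_assoc, Matrix.mul_apply, covForm, dotProduct]
    refine Finset.sum_congr rfl fun i _ => ?_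
    congr 1
  have h2 : 0 ≤ frobSq (covMat ν) :=
    Finset.sum_nonneg fun i _ => Finset.sum_nonneg fun j _ => sq_nonneg _
  rw [h1, varsig, Real.sq_sqrt h2, frobSq_eq_trace, covMat_transpose, Matrix.mul_assoc,
    Matrix.trace_mul_comm,
    Matrix.mul_assoc, ← hA]

theorem measurable_covForm : Measurable (covForm ν) := by
  have : covForm ν = fun a => ∑ i, ∑ j, a i * a j * covMat ν i j := funext covForm_eq_sum
  rw [this]
  fun_prop

theorem varsig_pos (hne : covMat ν ≠ 0) : 0 < varsig ν := by
  refine Real.sqrt_pos.2 (lt_of_le_of_ne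
    (Finset.sum_nonneg fun i _ => Finset.sum_nonneg fun j _ => sq_nonneg _) fun h => hne ?_)
  ext i j
  have h1 := (Finset.sum_eq_zero_iff_of_nonneg fun i _ =>
    Finset.sum_nonneg fun j _ => sq_nonneg _).1 h.symm i (Finset.mem_univ i)
  have h2 := (Finset.sum_eq_zero_iff_of_nonneg fun j _ => sq_nonneg _).1 h1 j (Finset.mem_univ j)
  simpa using h2

theorem integrable_inner_sq (h2 : MemLp id 2 ν) (a : EuclideanSpace ℝ (Fin d)) :
    Integrable (fun x => inner ℝ x a ^ 2) ν := (h2.inner_const a).integrable_sq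

variable [IsProbabilityMeasure ν]

theorem integral_inner_eq_zero (h2 : MemLp id 2 ν) (h0 : ∫ x, x ∂ν = 0)
    (a : EuclideanSpace ℝ (Fin d)) : ∫ x, inner ℝ x a ∂ν = 0 := by
  have h := integral_inner (𝕜 := ℝ) (f := fun x => x) (h2.integrable (by norm_num)) a
  rw [h0, inner_zero_right] at h
  simpa only [real_inner_comm] using h

theorem integral_inner_sq (h2 : MemLp id 2 ν) (h0 : ∫ x, x ∂ν = 0)
    (a : EuclideanSpace ℝ (Fin d)) : ∫ x, inner ℝ x a ^ 2 ∂ν = covForm ν a := by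
  have h1 := covarianceBilin_apply_pi (μ := ν) (X := fun i x => x i)
    (fun i => MemLp.eval_piLp h2 i) a a
  have e : (fun x : EuclideanSpace ℝ (Fin d) => WithLp.toLp 2 fun i => x i) = id := rfl
  rw [e, Measure.map_id, covarianceBilin_apply h2] at h1
  have h0' : ∫ x, id x ∂ν = 0 := h0
  simp only [h0', sub_zero] at h1
  rw [covForm_eq_sum]
  refine Eq.trans ?_ h1
  exact integral_congr_ae (Eventually.of_forall fun x => by
    dsimp only
    rw [sq, real_inner_comm])

theorem posSemidef_covMat (h2 : MemLp id 2 ν) (h0 : ∫ x, x ∂ν = 0) : (covMat ν).PosSemidef := by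
  refine Matrix.PosSemidef.of_dotProduct_mulVec_nonneg ?_ fun x => ?_
  · rw [Matrix.IsHermitian, Matrix.conjTranspose_eq_transpose_of_trivial, covMat_transpose]
  · have h := integral_inner_sq h2 h0 (WithLp.toLp 2 x)
    rw [covForm] at h
    rw [star_trivial, ← h]
    exact integral_nonneg fun _ => sq_nonneg _

theorem exists_covMat_factor (h2 : MemLp id 2 ν) (h0 : ∫ x, x ∂ν = 0) :
    ∃ A : Matrix (Fin d) (Fin d) ℝ, covMat ν = Aᵀ * A := by
  open scoped MatrixOrder in
  obtain ⟨a, ha⟩ := CStarAlgebra.nonneg_iff_eq_star_mul_self.mp (posSemidef_covMat h2 h0).nonneg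
  exact ⟨a, by rw [ha, Matrix.star_eq_conjTranspose,
    Matrix.conjTranspose_eq_transpose_of_trivial]⟩

theorem covForm_nonneg (h2 : MemLp id 2 ν) (h0 : ∫ x, x ∂ν = 0)
    (a : EuclideanSpace ℝ (Fin d)) : 0 ≤ covForm ν a := by
  rw [← integral_inner_sq h2 h0]
  exact integral_nonneg fun _ => sq_nonneg _

/-- The Gaussian distribution matching the first two moments of a centred `ν`. -/
theorem map_inner_multivariateGaussian (h2 : MemLp id 2 ν) (h0 : ∫ x, x ∂ν = 0)
    (a : EuclideanSpace ℝ (Fin d)) :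
    (multivariateGaussian 0 (covMat ν)).map (fun x => inner ℝ x a) =
      gaussianReal 0 (covForm ν a).toNNReal := by
  have h := IsGaussian.map_eq_gaussianReal (μ := multivariateGaussian 0 (covMat ν))
    (innerSL ℝ a)
  have e : (fun x => inner ℝ x a) = (innerSL ℝ a : EuclideanSpace ℝ (Fin d) → ℝ) :=
    funext fun x => by rw [innerSL_apply_apply, real_inner_comm]
  rw [e, h]
  congr 2
  · rw [(innerSL ℝ a).integral_comp_id_comm IsGaussian.integrable_id,
      integral_id_multivariateGaussian, map_zero]
  · have h3 := covarianceBilin_multivariateGaussian (μ := 0) (posSemidef_covMat h2 h0) a a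
    rw [covarianceBilin_self IsGaussian.memLp_two_id] at h3
    exact h3

theorem lintegral_abs_inner_rpow_gaussian (h2 : MemLp id 2 ν) (h0 : ∫ x, x ∂ν = 0) {q : ℝ}
    (a : EuclideanSpace ℝ (Fin d)) :
    ∫⁻ x, ENNReal.ofReal (|inner ℝ x a| ^ q) ∂(multivariateGaussian 0 (covMat ν)) =
      gaussMoment q * ENNReal.ofReal (covForm ν a ^ (q / 2)) := by
  have hm : Measurable fun t : ℝ => ENNReal.ofReal (|t| ^ q) := by fun_prop
  rw [← lintegral_map (f := fun t : ℝ => ENNReal.ofReal (|t| ^ q)) hm (by fun_prop),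
    map_inner_multivariateGaussian h2 h0, lintegral_abs_rpow_gaussianReal,
    Real.coe_toNNReal _ (covForm_nonneg h2 h0 a)]

theorem integral_inner_sq_gaussian (h2 : MemLp id 2 ν) (h0 : ∫ x, x ∂ν = 0)
    (a : EuclideanSpace ℝ (Fin d)) :
    ∫ x, inner ℝ x a ^ 2 ∂(multivariateGaussian 0 (covMat ν)) = covForm ν a := by
  rw [integral_inner_sq IsGaussian.memLp_two_id integral_id_multivariateGaussian, covForm, covForm]
  congr 2
  ext i j
  rw [covMat, Matrix.of_apply, covariance_eval_multivariateGaussian (posSemidef_covMat h2 h0)]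

/-- With Σ = AᵀA the covariance form at x is a sum of squares of Gaussian variables ⟨x, A_k⟩.
Minkowski in L^(q/2) adds their norms, which are proportional to the variances, and these sum to ς².
-/
theorem lintegral_covForm_rpow_gaussian_le (h2 : MemLp id 2 ν) (h0 : ∫ x, x ∂ν = 0) {q : ℝ}
    (hq : 2 < q) :
    ∫⁻ x, ENNReal.ofReal (covForm ν x ^ (q / 2)) ∂(multivariateGaussian 0 (covMat ν)) ≤
      gaussMoment q * ENNReal.ofReal (varsig ν ^ q) := by
  obtain ⟨A, hA⟩ := exists_covMat_factor h2 h0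
  set s : Fin d → EuclideanSpace ℝ (Fin d) := fun k => WithLp.toLp 2 (A k) with hs
  set f : Fin d → EuclideanSpace ℝ (Fin d) → ℝ≥0∞ :=
    fun k x => ENNReal.ofReal (inner ℝ x (s k) ^ 2) with hf
  have hq2 : 0 < q / 2 := by linarith
  have hM := eLpNorm'_sum_le (μ := multivariateGaussian 0 (covMat ν)) (s := Finset.univ) (f := f)
    (q := q / 2) (fun k _ => by
      have : Measurable (f k) := by fun_prop
      exact this.aestronglyMeasurable) (by linarith)
  have hk : ∀ k, eLpNorm' (f k) (q / 2) (multivariateGaussian 0 (covMat ν)) =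
      gaussMoment q ^ (1 / (q / 2)) * ENNReal.ofReal (covForm ν (s k)) := by
    intro k
    have e : ∀ x, ‖f k x‖ₑ ^ (q / 2) = ENNReal.ofReal (|inner ℝ x (s k)| ^ q) := fun x => by
      rw [enorm_eq_self, hf, ENNReal.ofReal_rpow_of_nonneg (sq_nonneg _) hq2.le]
      rw [← sq_abs, ← Real.rpow_natCast, ← Real.rpow_mul (abs_nonneg _)]
      congr 2
      push_cast
      ring
    rw [eLpNorm'_eq_lintegral_enorm, lintegral_congr e, lintegral_abs_inner_rpow_gaussian h2 h0,
      ENNReal.mul_rpow_of_nonneg _ _ (by positivity), ENNReal.ofReal_rpow_of_nonneg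
        (Real.rpow_nonneg (covForm_nonneg h2 h0 _) _) (by positivity),
      ← Real.rpow_mul (covForm_nonneg h2 h0 _), mul_one_div_cancel hq2.ne', Real.rpow_one]
  simp_rw [hk] at hM
  rw [← Finset.mul_sum, ← ENNReal.ofReal_sum_of_nonneg fun k _ => covForm_nonneg h2 h0 _,
    sum_covForm_factor hA] at hM
  have hM2 := ENNReal.rpow_le_rpow hM hq2.le
  have e2 : ∀ x, ‖(∑ k, f k) x‖ₑ ^ (q / 2) = ENNReal.ofReal (covForm ν x ^ (q / 2)) := fun x => by
    rw [enorm_eq_self, Finset.sum_apply, hf, ← ENNReal.ofReal_sum_of_nonneg fun k _ => sq_nonneg _,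
      ← covForm_eq_of_factor hA, ENNReal.ofReal_rpow_of_nonneg (covForm_nonneg h2 h0 _) hq2.le]
  have hv : 0 ≤ varsig ν := Real.sqrt_nonneg _
  rw [eLpNorm'_eq_lintegral_enorm, lintegral_congr e2, ← ENNReal.rpow_mul,
    one_div_mul_cancel hq2.ne', ENNReal.rpow_one, ENNReal.mul_rpow_of_nonneg _ _ hq2.le,
    ← ENNReal.rpow_mul, one_div_mul_cancel hq2.ne', ENNReal.rpow_one,
    ENNReal.ofReal_rpow_of_nonneg (by positivity) hq2.le, ← Real.rpow_natCast,
    ← Real.rpow_mul hv] at hM2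
  refine hM2.trans_eq ?_
  congr 3
  push_cast
  ring

theorem momentM_eq (hne : covMat ν ≠ 0) {q : ℝ} :
    ∫⁻ x, ∫⁻ y, ENNReal.ofReal (|inner ℝ x y| ^ q) ∂ν ∂ν =
      ENNReal.ofReal (varsig ν ^ q) * momentM ν q := by
  have hv := varsig_pos hne
  have hm : Measurable fun p : EuclideanSpace ℝ (Fin d) × EuclideanSpace ℝ (Fin d) =>
      ENNReal.ofReal (|inner ℝ p.1 p.2 / varsig ν| ^ q) := by fun_prop
  rw [momentM, ← lintegral_const_mul _ hm.lintegral_prod_right']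
  refine lintegral_congr fun x => ?_
  rw [← lintegral_const_mul _ (by fun_prop)]
  refine lintegral_congr fun y => ?_
  rw [← ENNReal.ofReal_mul (by positivity), abs_div, abs_of_pos hv,
    Real.div_rpow (abs_nonneg _) hv.le, mul_div_cancel₀ _ (Real.rpow_pos_of_pos hv q).ne']

theorem momentL_eq (h2 : MemLp id 2 ν) (h0 : ∫ x, x ∂ν = 0) (hne : covMat ν ≠ 0) {q : ℝ} :
    ∫⁻ x, ENNReal.ofReal (covForm ν x ^ (q / 2)) ∂ν =
      ENNReal.ofReal (varsig ν ^ q) * momentL ν q := by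
  have hv := varsig_pos hne
  have hm : Measurable fun x : EuclideanSpace ℝ (Fin d) =>
      ENNReal.ofReal (|covForm ν x / varsig ν ^ 2| ^ (q / 2)) := by
    have := measurable_covForm (ν := ν)
    fun_prop
  change _ = _ * ∫⁻ x, ENNReal.ofReal (|covForm ν x / varsig ν ^ 2| ^ (q / 2)) ∂ν
  rw [← lintegral_const_mul _ hm]
  refine lintegral_congr fun x => ?_
  have hx := covForm_nonneg h2 h0 x
  rw [← ENNReal.ofReal_mul (by positivity), abs_of_nonneg (by positivity),
    Real.div_rpow hx (by positivity), ← Real.rpow_natCast, ← Real.rpow_mul hv.le]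
  have e : ((2 : ℕ) : ℝ) * (q / 2) = q := by push_cast; ring
  rw [e, mul_div_cancel₀ _ (Real.rpow_pos_of_pos hv q).ne']

/-- `L_q ≥ 1`, since `V₁ᵀ Σ V₁ / ς²` has mean one. -/
theorem one_le_momentL (h2 : MemLp id 2 ν) (h0 : ∫ x, x ∂ν = 0) (hne : covMat ν ≠ 0) {q : ℝ}
    (hq : 2 < q) : 1 ≤ momentL ν q := by
  have hv := varsig_pos hne
  obtain ⟨A, hA⟩ := exists_covMat_factor h2 h0
  have hi : Integrable (fun x => covForm ν x) ν := by
    simp_rw [covForm_eq_of_factor hA]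
    exact integrable_finsetSum _ fun k _ => integrable_inner_sq h2 _
  have hI : ∫ x, covForm ν x ∂ν = varsig ν ^ 2 := by
    rw [← sum_covForm_factor hA]
    simp_rw [← integral_inner_sq h2 h0 (WithLp.toLp 2 (A _))]
    rw [← integral_finsetSum _ fun k _ => integrable_inner_sq h2 _]
    exact integral_congr_ae (Eventually.of_forall fun x => covForm_eq_of_factor hA x)
  by_cases htop : momentL ν q = ∞
  · rw [htop]; exact le_top
  set g : EuclideanSpace ℝ (Fin d) → ℝ := fun x => |covForm ν x / varsig ν ^ 2| ^ (q / 2) with hg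
  have hgm : Measurable g := by
    have := measurable_covForm (ν := ν)
    fun_prop
  have hgi : Integrable g ν := (lintegral_ofReal_ne_top_iff_integrable
    hgm.aestronglyMeasurable (Eventually.of_forall fun t => by positivity)).1 htop
  have hge : (1 : ℝ) ≤ ∫ x, g x ∂ν := by
    have hsi : Integrable (fun x => covForm ν x / varsig ν ^ 2 - 1) ν :=
      (hi.div_const _).sub (integrable_const _)
    have hli : Integrable (fun x => 1 + q / 2 * (covForm ν x / varsig ν ^ 2 - 1)) ν :=
      (integrable_const _).add (hsi.const_mul _)
    have h1 : ∫ x, (1 + q / 2 * (covForm ν x / varsig ν ^ 2 - 1)) ∂ν = 1 := by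
      rw [integral_add (integrable_const _) (hsi.const_mul _), integral_const_mul,
        integral_sub (hi.div_const _) (integrable_const _),
        integral_div, hI, div_self (by positivity)]
      simp
    rw [← h1]
    refine integral_mono hli hgi fun x => ?_
    have hx : 0 ≤ covForm ν x / varsig ν ^ 2 := div_nonneg (covForm_nonneg h2 h0 x) (by positivity)
    -- Bernoulli's inequality is the tangent line at the mean value one, so integrating it gives
    -- Jensen's inequality.
    have := one_add_mul_self_le_rpow_one_add (s := covForm ν x / varsig ν ^ 2 - 1) (by linarith)
      (p := q / 2) (by linarith)
    rw [add_sub_cancel] at this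
    rw [hg]
    dsimp only
    rwa [abs_of_nonneg hx]
  calc (1 : ℝ≥0∞) = ENNReal.ofReal 1 := by simp
    _ ≤ ENNReal.ofReal (∫ x, g x ∂ν) := ENNReal.ofReal_le_ofReal hge
    _ = _ := ofReal_integral_eq_lintegral_ofReal hgi (Eventually.of_forall fun t => by positivity)

end Covariance

/-- `F` has quadratic Taylor expansions with errors at most `L |y| ^ q`. -/
def HasQuadTaylor (F : ℝ → ℝ) (q L : ℝ) : Prop :=
  ∃ F' F'' : ℝ → ℝ, ∀ r y : ℝ, |F (r + y) - F r - F' r * y - F'' r * y ^ 2 / 2| ≤ L * |y| ^ q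

theorem HasQuadTaylor.comp_sub_div {F : ℝ → ℝ} {q L : ℝ} (h : HasQuadTaylor F q L) (z : ℝ)
    {ε : ℝ} (hε : 0 < ε) : HasQuadTaylor (fun t => F ((t - z) / ε)) q (L * ε ^ (-q)) := by
  obtain ⟨F', F'', hF⟩ := h
  refine ⟨fun t => F' ((t - z) / ε) / ε, fun t => F'' ((t - z) / ε) / ε ^ 2, fun r y => ?_⟩
  have h1 := hF ((r - z) / ε) (y / ε)
  rw [abs_div, abs_of_pos hε, Real.div_rpow (abs_nonneg _) hε.le] at h1
  rw [Real.rpow_neg hε.le]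
  convert h1 using 1
  · congr 1
    rw [← add_div]
    have : r - z + y = r + y - z := by ring
    rw [this]
    ring
  · ring

/-! ### Exchanging one summand. -/

section OneStep

variable {d : ℕ} {q L : ℝ} {F : ℝ → ℝ}

/-- The linear Taylor term integrates to zero and the quadratic one sees η only through its second
moment, so the comparison value is common to all centred laws with the same covariance. The
right-hand side may be infinite. -/
theorem ofReal_abs_integral_sub_taylor_le (hL : 0 ≤ L) (hFc : Continuous F)
    (hF0 : ∀ x, 0 ≤ F x) (hF1 : ∀ x, F x ≤ 1) {F' F'' : ℝ → ℝ}
    (hT : ∀ r y : ℝ, |F (r + y) - F r - F' r * y - F'' r * y ^ 2 / 2| ≤ L * |y| ^ q)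
    (η : Measure (EuclideanSpace ℝ (Fin d))) [IsProbabilityMeasure η] (h2 : MemLp id 2 η)
    (h0 : ∫ x, x ∂η = 0) (r : ℝ) (b : EuclideanSpace ℝ (Fin d)) :
    ENNReal.ofReal |∫ x, F (r + inner ℝ x b) ∂η - (F r + F'' r * (∫ x, inner ℝ x b ^ 2 ∂η) / 2)| ≤
      ENNReal.ofReal L * ∫⁻ x, ENNReal.ofReal (|inner ℝ x b| ^ q) ∂η := by
  have hi1 : Integrable (fun x => inner ℝ x b) η := (h2.inner_const b).integrable (by norm_num)
  have hi2 := integrable_inner_sq h2 b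
  have hiF : Integrable (fun x => F (r + inner ℝ x b)) η := by
    refine Integrable.of_bound (C := 1) ?_ (Eventually.of_forall fun x => ?_)
    · have : Continuous fun x : EuclideanSpace ℝ (Fin d) => F (r + inner ℝ x b) := by fun_prop
      exact this.aestronglyMeasurable
    · rw [Real.norm_eq_abs, abs_of_nonneg (hF0 _)]
      exact hF1 _
  have hiA : Integrable (fun x => F (r + inner ℝ x b) - F r) η := hiF.sub (integrable_const _)
  have hiB : Integrable (fun x => F' r * inner ℝ x b) η := hi1.const_mul _
  have hiC : Integrable (fun x => F'' r * inner ℝ x b ^ 2 / 2) η := (hi2.const_mul _).div_const _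
  have hiD : Integrable (fun x => F (r + inner ℝ x b) - F r - F' r * inner ℝ x b) η := hiA.sub hiB
  have e : ∫ x, F (r + inner ℝ x b) ∂η - (F r + F'' r * (∫ x, inner ℝ x b ^ 2 ∂η) / 2) =
      ∫ x, (F (r + inner ℝ x b) - F r - F' r * inner ℝ x b - F'' r * inner ℝ x b ^ 2 / 2) ∂η := by
    rw [integral_sub hiD hiC, integral_sub hiA hiB, integral_sub hiF (integrable_const _),
      integral_const_mul, integral_inner_eq_zero h2 h0, integral_div, integral_const_mul]
    simp
    ring
  rw [e, ← Real.norm_eq_abs, ofReal_norm, ← lintegral_const_mul _ (by fun_prop)]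
  refine (enorm_integral_le_lintegral_enorm _).trans (lintegral_mono fun x => ?_)
  rw [← ofReal_norm, ← ENNReal.ofReal_mul hL]
  exact ENNReal.ofReal_le_ofReal (hT _ _)

/-- Exchanging the distribution of one summand for another one with the same first two moments. -/
theorem ofReal_abs_integral_sub_integral_le (hL : 0 ≤ L) (hFc : Continuous F)
    (hF0 : ∀ x, 0 ≤ F x) (hF1 : ∀ x, F x ≤ 1) (hT : HasQuadTaylor F q L)
    (η₁ η₂ : Measure (EuclideanSpace ℝ (Fin d))) [IsProbabilityMeasure η₁] [IsProbabilityMeasure η₂]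
    (h2 : MemLp id 2 η₁) (h0 : ∫ x, x ∂η₁ = 0) (h2' : MemLp id 2 η₂) (h0' : ∫ x, x ∂η₂ = 0)
    (r : ℝ) (b : EuclideanSpace ℝ (Fin d))
    (hcov : ∫ x, inner ℝ x b ^ 2 ∂η₁ = ∫ x, inner ℝ x b ^ 2 ∂η₂) :
    ENNReal.ofReal |∫ x, F (r + inner ℝ x b) ∂η₁ - ∫ x, F (r + inner ℝ x b) ∂η₂| ≤
      ENNReal.ofReal L * (∫⁻ x, ENNReal.ofReal (|inner ℝ x b| ^ q) ∂η₁ +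
        ∫⁻ x, ENNReal.ofReal (|inner ℝ x b| ^ q) ∂η₂) := by
  obtain ⟨F', F'', hF⟩ := hT
  have h1 := ofReal_abs_integral_sub_taylor_le hL hFc hF0 hF1 hF η₁ h2 h0 r b
  have h3 := ofReal_abs_integral_sub_taylor_le hL hFc hF0 hF1 hF η₂ h2' h0' r b
  rw [hcov] at h1
  rw [mul_add]
  refine le_trans ?_ (add_le_add h1 h3)
  rw [← ENNReal.ofReal_add (abs_nonneg _) (abs_nonneg _)]
  refine ENNReal.ofReal_le_ofReal ?_
  refine (abs_sub_le _ (F r + F'' r * (∫ x, inner ℝ x b ^ 2 ∂η₂) / 2) _).trans ?_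
  rw [abs_sub_comm (F r + _)]

end OneStep

/-! ### Resampling one coordinate of a product measure. -/

section ProductUpdate

variable {ι : Type*} [Fintype ι] [DecidableEq ι] {α : Type*} [MeasurableSpace α]
  {μ μ' : ι → Measure α} [∀ i, IsProbabilityMeasure (μ i)] [∀ i, IsProbabilityMeasure (μ' i)]

theorem map_update_prod_pi (i : ι) (h : ∀ j, j ≠ i → μ' j = μ j) :
    ((Measure.pi μ).prod (μ' i)).map (fun p => Function.update p.1 i p.2) = Measure.pi μ' := by
  refine (Measure.pi_eq fun s hs => ?_).symm
  rw [Measure.map_apply measurable_update' (MeasurableSet.univ_pi hs)]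
  have e : (fun p : (ι → α) × α => Function.update p.1 i p.2) ⁻¹' Set.univ.pi s =
      (Set.univ.pi (Function.update s i Set.univ)) ×ˢ s i := by
    ext ⟨v, x⟩
    simp only [Set.mem_preimage, Set.mem_univ_pi, Set.mem_prod]
    constructor
    · intro hv
      refine ⟨fun j => ?_, by simpa using hv i⟩
      by_cases hj : j = i
      · subst hj; simp
      · have := hv j
        simpa [Function.update_of_ne hj] using this
    · rintro ⟨hv, hx⟩ j
      by_cases hj : j = i
      · subst hj; simpa using hx
      · have := hv j
        simpa [Function.update_of_ne hj] using this
  rw [e, Measure.prod_prod, Measure.pi_pi, ← Finset.mul_prod_erase _ _ (Finset.mem_univ i),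
    ← Finset.mul_prod_erase (a := i) _ (fun j => μ' j (s j)) (Finset.mem_univ i),
    Function.update_self, measure_univ, one_mul, mul_comm]
  congr 1
  refine Finset.prod_congr rfl fun j hj => ?_
  rw [Function.update_of_ne (Finset.ne_of_mem_erase hj), h j (Finset.ne_of_mem_erase hj)]

/-- Brings two product measures that differ only in the i-th factor to the same outer measure: the
i-th coordinate of v is overwritten, so its law does not matter. -/
theorem integral_pi_eq_integral_update (i : ι) (h : ∀ j, j ≠ i → μ' j = μ j) {F : (ι → α) → ℝ}
    (hF : Measurable F) (hF0 : ∀ v, 0 ≤ F v) (hF1 : ∀ v, F v ≤ 1) :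
    Integrable (fun v => ∫ x, F (Function.update v i x) ∂(μ' i)) (Measure.pi μ) ∧
    ∫ v, F v ∂(Measure.pi μ') = ∫ v, ∫ x, F (Function.update v i x) ∂(μ' i) ∂(Measure.pi μ) := by
  have hm : Measurable fun p : (ι → α) × α => F (Function.update p.1 i p.2) :=
    hF.comp measurable_update'
  have hi : Integrable (fun p : (ι → α) × α => F (Function.update p.1 i p.2))
      ((Measure.pi μ).prod (μ' i)) := by
    refine Integrable.of_bound (C := 1) hm.aestronglyMeasurable (Eventually.of_forall fun x => ?_)
    rw [Real.norm_eq_abs, abs_of_nonneg (hF0 _)]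
    exact hF1 _
  refine ⟨hi.integral_prod_left, ?_⟩
  rw [← map_update_prod_pi i h, integral_map measurable_update'.aemeasurable
    hF.aestronglyMeasurable, integral_prod _ hi]

end ProductUpdate

/-! ### Quadratic forms with zero diagonal. -/

section QuadForm

variable {n d : ℕ} {K : Matrix (Fin n) (Fin n) ℝ}

theorem quadForm_eq_sum (v : Fin n → EuclideanSpace ℝ (Fin d)) :
    quadForm K v = ∑ i, ∑ j, K i j * inner ℝ (v i) (v j) := by
  rw [quadForm, Matrix.mul_assoc, Matrix.trace_mul_comm, Matrix.trace]
  refine Finset.sum_congr rfl fun i _ => ?_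
  rw [Matrix.diag_apply, Matrix.mul_assoc, Matrix.mul_apply]
  refine Finset.sum_congr rfl fun j _ => ?_
  congr 1

theorem measurable_quadForm :
    Measurable (quadForm K : (Fin n → EuclideanSpace ℝ (Fin d)) → ℝ) := by
  have : (quadForm K : (Fin n → EuclideanSpace ℝ (Fin d)) → ℝ) =
      fun v => ∑ i, ∑ j, K i j * inner ℝ (v i) (v j) := funext quadForm_eq_sum
  rw [this]
  fun_prop

/-- A vanishing diagonal makes the form affine in each row; the factor 2 comes from symmetry. The
term j = i of the slope is zero, so the slope does not involve the row being replaced. -/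
theorem quadForm_update (hK : Kᵀ = K) (hd : ∀ i, K i i = 0) (i : Fin n)
    (v : Fin n → EuclideanSpace ℝ (Fin d)) (x : EuclideanSpace ℝ (Fin d)) :
    quadForm K (Function.update v i x) = quadForm K (Function.update v i 0) +
      inner ℝ x (∑ j, (2 * K i j) • v j) := by
  have hs : ∀ a b, K a b = K b a := fun a b => by
    conv_lhs => rw [← hK, Matrix.transpose_apply]
  have expand : ∀ y : EuclideanSpace ℝ (Fin d), quadForm K (Function.update v i y) =
      2 * ∑ j ∈ Finset.univ.erase i, K i j * inner ℝ y (v j) +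
      ∑ a ∈ Finset.univ.erase i, ∑ b ∈ Finset.univ.erase i, K a b * inner ℝ (v a) (v b) := by
    intro y
    rw [quadForm_eq_sum, ← Finset.add_sum_erase _ _ (Finset.mem_univ i),
      ← Finset.add_sum_erase _ _ (Finset.mem_univ i), hd, zero_mul, zero_add, two_mul, add_assoc]
    congr 1
    · refine Finset.sum_congr rfl fun j hj => ?_
      rw [Function.update_self, Function.update_of_ne (Finset.ne_of_mem_erase hj)]
    · rw [← Finset.sum_add_distrib]
      refine Finset.sum_congr rfl fun a ha => ?_
      rw [← Finset.add_sum_erase _ _ (Finset.mem_univ i), Function.update_self,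
        Function.update_of_ne (Finset.ne_of_mem_erase ha), hs a i, real_inner_comm]
      congr 1
      refine Finset.sum_congr rfl fun b hb => ?_
      rw [Function.update_of_ne (Finset.ne_of_mem_erase hb)]
  rw [expand, expand, inner_sum, ← Finset.add_sum_erase _ _ (Finset.mem_univ i), hd]
  simp only [inner_zero_left, mul_zero, Finset.sum_const_zero, zero_add, zero_smul,
    inner_zero_right, real_inner_smul_right]
  rw [Finset.mul_sum, add_comm]
  congr 1
  exact Finset.sum_congr rfl fun j _ => by ring

end QuadForm

/-! ### The q-th moment of the linear coefficient. -/

section MomentBound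

variable {n d : ℕ} {q : ℝ}

/-- After exchanging the integrals, x is fixed and Rosenthal applies to the independent centred
variables c_j⟨x, v_j⟩ of variance c_j² V(x). Integrating over x turns the two Rosenthal terms into
the cross moment D and the moment A of V. -/
theorem lintegral_abs_inner_sum_rpow_le (hq : 2 < q) (hq3 : q ≤ 3)
    {η : Measure (EuclideanSpace ℝ (Fin d))} [IsProbabilityMeasure η]
    {μ : Fin n → Measure (EuclideanSpace ℝ (Fin d))} [∀ j, IsProbabilityMeasure (μ j)]
    (h2 : ∀ j, MemLp id 2 (μ j)) (h0 : ∀ j, ∫ x, x ∂(μ j) = 0)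
    {V : EuclideanSpace ℝ (Fin d) → ℝ} (hVm : Measurable V) (hV0 : ∀ a, 0 ≤ V a)
    (hV : ∀ j a, ∫ x, inner ℝ x a ^ 2 ∂(μ j) = V a) {D A : ℝ≥0∞}
    (hD : ∀ j, ∫⁻ x, ∫⁻ y, ENNReal.ofReal (|inner ℝ x y| ^ q) ∂(μ j) ∂η ≤ D)
    (hA : ∫⁻ x, ENNReal.ofReal (V x ^ (q / 2)) ∂η ≤ A) (c : Fin n → ℝ) :
    ∫⁻ v, ∫⁻ x, ENNReal.ofReal (|inner ℝ x (∑ j, c j • v j)| ^ q) ∂η ∂(Measure.pi μ) ≤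
      6 * (∑ j, ENNReal.ofReal (|c j| ^ q) * D +
        ENNReal.ofReal ((∑ j, c j ^ 2) ^ (q / 2)) * A) := by
  have hm : Measurable fun p : (Fin n → EuclideanSpace ℝ (Fin d)) × EuclideanSpace ℝ (Fin d) =>
      ENNReal.ofReal (|inner ℝ p.2 (∑ j, c j • p.1 j)| ^ q) := by fun_prop
  have hm2 : Measurable fun p : EuclideanSpace ℝ (Fin d) × EuclideanSpace ℝ (Fin d) =>
      ENNReal.ofReal (|inner ℝ p.1 p.2| ^ q) := by fun_prop
  have hm3 : ∀ j, Measurable fun x : EuclideanSpace ℝ (Fin d) =>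
      ∫⁻ y, ENNReal.ofReal (|inner ℝ x y| ^ q) ∂(μ j) := fun j => hm2.lintegral_prod_right'
  rw [lintegral_lintegral_swap hm.aemeasurable]
  have hx : ∀ x : EuclideanSpace ℝ (Fin d),
      ∫⁻ v, ENNReal.ofReal (|inner ℝ x (∑ j, c j • v j)| ^ q) ∂(Measure.pi μ) ≤
      6 * (∑ j, ENNReal.ofReal (|c j| ^ q) * ∫⁻ y, ENNReal.ofReal (|inner ℝ x y| ^ q) ∂(μ j) +
        ENNReal.ofReal ((∑ j, c j ^ 2) ^ (q / 2)) * ENNReal.ofReal (V x ^ (q / 2))) := by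
    intro x
    have hg : ∀ j, Measurable fun y : EuclideanSpace ℝ (Fin d) => c j * inner ℝ x y := fun j => by
      fun_prop
    have hR := lintegral_abs_rpow_sum_le (μ := Measure.pi μ) hq hq3
      (ξ := fun j v => c j * inner ℝ x (v j))
      (iIndepFun_pi (X := fun j y => c j * inner ℝ x y) fun j => (hg j).aemeasurable)
      (fun j => (hg j).comp (measurable_pi_apply j)) (fun j => by
        rw [integral_comp_eval (μ := μ) (i := j) (f := fun y => c j * inner ℝ x y)
          (hg j).aestronglyMeasurable, integral_const_mul]
        rw [show (fun y => inner ℝ x y) = fun y => inner ℝ y x from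
          funext fun y => real_inner_comm _ _, integral_inner_eq_zero (h2 j) (h0 j) x, mul_zero])
    have e1 : ∀ v : Fin n → EuclideanSpace ℝ (Fin d),
        inner ℝ x (∑ j, c j • v j) = ∑ j, c j * inner ℝ x (v j) := fun v => by
      simp only [inner_sum, real_inner_smul_right]
    simp only [e1]
    refine hR.trans_eq ?_
    congr 2
    · refine Finset.sum_congr rfl fun j _ => ?_
      have hg2 : Measurable fun y : EuclideanSpace ℝ (Fin d) =>
        ENNReal.ofReal (|c j * inner ℝ x y| ^ q) := by fun_prop
      have e2 := (measurePreserving_eval μ j).lintegral_comp hg2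
      refine e2.trans ?_
      rw [← lintegral_const_mul _ (by fun_prop)]
      refine lintegral_congr fun y => ?_
      rw [← ENNReal.ofReal_mul (by positivity), abs_mul,
        Real.mul_rpow (abs_nonneg _) (abs_nonneg _)]
    · rw [← ENNReal.ofReal_mul (by positivity), ← Real.mul_rpow
        (Finset.sum_nonneg fun j _ => sq_nonneg _) (hV0 x), Finset.sum_mul]
      congr 2
      refine Finset.sum_congr rfl fun j _ => ?_
      rw [integral_comp_eval (μ := μ) (i := j) (f := fun y => (c j * inner ℝ x y) ^ 2)
        ((hg j).pow_const 2).aestronglyMeasurable, ← hV j x, ← integral_const_mul]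
      refine integral_congr_ae (Eventually.of_forall fun y => ?_)
      dsimp only
      rw [mul_pow, real_inner_comm]
  have hVq : Measurable fun x => ENNReal.ofReal (V x ^ (q / 2)) := by fun_prop
  refine (lintegral_mono hx).trans ?_
  rw [lintegral_const_mul _ (by fun_prop), lintegral_add_left (by fun_prop),
    lintegral_finsetSum _ (fun j _ => (hm3 j).const_mul _), lintegral_const_mul _ hVq]
  gcongr with j
  rw [lintegral_const_mul _ (hm3 j)]
  gcongr
  exact hD j

end MomentBound

theorem sum_abs_rpow_le_rpow_sum_sq {ι : Type*} (s : Finset ι) (c : ι → ℝ) {q : ℝ} (hq : 2 ≤ q) :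
    ∑ j ∈ s, |c j| ^ q ≤ (∑ j ∈ s, c j ^ 2) ^ (q / 2) := by
  classical
  induction s using Finset.induction_on with
  | empty => simp; positivity
  | insert a s ha ih =>
    rw [Finset.sum_insert ha, Finset.sum_insert ha]
    have e : |c a| ^ q = (c a ^ 2) ^ (q / 2) := by
      rw [← sq_abs, ← Real.rpow_natCast, ← Real.rpow_mul (abs_nonneg _)]
      congr 1
      push_cast
      ring
    rw [e]
    exact (add_le_add_right ih _).trans (Real.add_rpow_le_rpow_add (sq_nonneg _)
      (Finset.sum_nonneg fun j _ => sq_nonneg _) (by linarith))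

/-! ### Lindeberg replacement. -/

section Lindeberg

variable {n d : ℕ} {ν : Measure (EuclideanSpace ℝ (Fin d))} [IsProbabilityMeasure ν] {q : ℝ}

/-- Integrating out a Gaussian argument leaves a power of the covariance form of the other one.
Mixed pairs therefore produce L_q, and two Gaussians produce a constant, which is absorbed since L_q
≥ 1. -/
theorem cross_moment_le (h2 : MemLp id 2 ν) (h0 : ∫ x, x ∂ν = 0) (hne : covMat ν ≠ 0) (hq : 2 < q)
    {η μ : Measure (EuclideanSpace ℝ (Fin d))}
    (hη : η = ν ∨ η = multivariateGaussian 0 (covMat ν))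
    (hμ : μ = ν ∨ μ = multivariateGaussian 0 (covMat ν)) :
    ∫⁻ x, ∫⁻ y, ENNReal.ofReal (|inner ℝ x y| ^ q) ∂μ ∂η ≤ ENNReal.ofReal (varsig ν ^ q) *
      (momentM ν q + (1 + gaussMoment q) ^ 2 * momentL ν q) := by
  have hVm : Measurable fun x => ENNReal.ofReal (covForm ν x ^ (q / 2)) := by
    have := measurable_covForm (ν := ν)
    fun_prop
  have hinner : ∀ x : EuclideanSpace ℝ (Fin d),
      ∫⁻ y, ENNReal.ofReal (|inner ℝ x y| ^ q) ∂(multivariateGaussian 0 (covMat ν)) =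
        gaussMoment q * ENNReal.ofReal (covForm ν x ^ (q / 2)) := fun x => by
    simp_rw [real_inner_comm _ x]
    exact lintegral_abs_inner_rpow_gaussian h2 h0 x
  have hνγ : ∫⁻ x, ∫⁻ y, ENNReal.ofReal (|inner ℝ x y| ^ q) ∂(multivariateGaussian 0 (covMat ν)) ∂ν
      ≤ ENNReal.ofReal (varsig ν ^ q) *
        (momentM ν q + (1 + gaussMoment q) ^ 2 * momentL ν q) := by
    simp_rw [hinner]
    rw [lintegral_const_mul _ hVm, momentL_eq h2 h0 hne, mul_left_comm]
    refine mul_le_mul_right (le_trans ?_ (self_le_add_left _ _)) _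
    refine mul_le_mul_left ?_ _
    calc gaussMoment q ≤ 1 + gaussMoment q := self_le_add_left _ _
      _ ≤ (1 + gaussMoment q) ^ 2 := le_self_pow (self_le_add_right _ _) two_ne_zero
  rcases hη with rfl | rfl <;> rcases hμ with rfl | rfl
  · rw [momentM_eq hne]
    exact mul_le_mul_right (self_le_add_right _ _) _
  · exact hνγ
  · rw [lintegral_lintegral_swap (by fun_prop)]
    simp_rw [real_inner_comm]
    exact hνγ
  · simp_rw [hinner]
    rw [lintegral_const_mul _ hVm]
    calc _ ≤ gaussMoment q * (gaussMoment q * ENNReal.ofReal (varsig ν ^ q)) := by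
          gcongr
          exact lintegral_covForm_rpow_gaussian_le h2 h0 hq
      _ = ENNReal.ofReal (varsig ν ^ q) * (gaussMoment q ^ 2 * 1) := by ring
      _ ≤ _ := by
          refine mul_le_mul_right (le_trans ?_ (self_le_add_left _ _)) _
          gcongr
          · exact self_le_add_left _ _
          · exact one_le_momentL h2 h0 hne hq

theorem covForm_moment_le (h2 : MemLp id 2 ν) (h0 : ∫ x, x ∂ν = 0) (hne : covMat ν ≠ 0)
    (hq : 2 < q) {η : Measure (EuclideanSpace ℝ (Fin d))}
    (hη : η = ν ∨ η = multivariateGaussian 0 (covMat ν)) :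
    ∫⁻ x, ENNReal.ofReal (covForm ν x ^ (q / 2)) ∂η ≤ ENNReal.ofReal (varsig ν ^ q) *
      ((1 + gaussMoment q) * momentL ν q) := by
  rcases hη with rfl | rfl
  · rw [momentL_eq h2 h0 hne]
    refine mul_le_mul_right ?_ _
    exact le_mul_of_one_le_left' (self_le_add_right _ _)
  · refine (lintegral_covForm_rpow_gaussian_le h2 h0 hq).trans ?_
    rw [mul_comm]
    refine mul_le_mul_right ?_ _
    exact (self_le_add_left _ _).trans (le_mul_of_one_le_right' (one_le_momentL h2 h0 hne hq))

/-- The contribution of the `i`-th row of `K` to the Lindeberg bound. -/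
noncomputable def rowMoment (K : Matrix (Fin n) (Fin n) ℝ)
    (ν : Measure (EuclideanSpace ℝ (Fin d))) (q : ℝ) (i : Fin n) : ℝ≥0∞ :=
  ENNReal.ofReal (∑ j, |K i j| ^ q) * momentM ν q +
    ENNReal.ofReal ((∑ j, K i j ^ 2) ^ (q / 2)) * momentL ν q

/-- The constant in the Lindeberg bound. -/
noncomputable def lindebergConst (q : ℝ) : ℝ≥0∞ :=
  96 * ((1 + gaussMoment q) ^ 2 + (1 + gaussMoment q))

theorem lindebergConst_ne_top (hq : 0 < q) : lindebergConst q ≠ ∞ := by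
  have := gaussMoment_ne_top hq
  unfold lindebergConst
  finiteness

theorem lintegral_row_rpow_le (h2 : MemLp id 2 ν) (h0 : ∫ x, x ∂ν = 0) (hne : covMat ν ≠ 0)
    (hq : 2 < q) (hq3 : q ≤ 3) (K : Matrix (Fin n) (Fin n) ℝ)
    {η : Measure (EuclideanSpace ℝ (Fin d))} [IsProbabilityMeasure η]
    (hη : η = ν ∨ η = multivariateGaussian 0 (covMat ν))
    {μ : Fin n → Measure (EuclideanSpace ℝ (Fin d))} [∀ j, IsProbabilityMeasure (μ j)]
    (hμ : ∀ j, μ j = ν ∨ μ j = multivariateGaussian 0 (covMat ν)) (i : Fin n) :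
    ∫⁻ v, ∫⁻ x, ENNReal.ofReal (|inner ℝ x (∑ j, (2 * K i j) • v j)| ^ q) ∂η ∂(Measure.pi μ) ≤
      48 * ((1 + gaussMoment q) ^ 2 + (1 + gaussMoment q)) * ENNReal.ofReal (varsig ν ^ q) *
        rowMoment K ν q i := by
  have hm2 : ∀ j, MemLp id 2 (μ j) := fun j => by
    rcases hμ j with h | h <;> rw [h]
    · exact h2
    · exact IsGaussian.memLp_two_id
  have hm0 : ∀ j, ∫ x, x ∂(μ j) = 0 := fun j => by
    rcases hμ j with h | h <;> rw [h]
    · exact h0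
    · exact integral_id_multivariateGaussian
  have hmV : ∀ j a, ∫ x, inner ℝ x a ^ 2 ∂(μ j) = covForm ν a := fun j a => by
    rcases hμ j with h | h <;> rw [h]
    · exact integral_inner_sq h2 h0 a
    · exact integral_inner_sq_gaussian h2 h0 a
  refine (lintegral_abs_inner_sum_rpow_le hq hq3 hm2 hm0 measurable_covForm
    (covForm_nonneg h2 h0) hmV (fun j => cross_moment_le h2 h0 hne hq hη (hμ j))
    (covForm_moment_le h2 h0 hne hq hη) (fun j => 2 * K i j)).trans ?_
  have h8 : (2 : ℝ) ^ q ≤ 8 := by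
    calc (2 : ℝ) ^ q ≤ 2 ^ (3 : ℝ) := Real.rpow_le_rpow_of_exponent_le (by norm_num) hq3
      _ = 8 := by norm_num
  have hS : 0 ≤ ∑ j, K i j ^ 2 := Finset.sum_nonneg fun j _ => sq_nonneg _
  have ha : ∑ j, ENNReal.ofReal (|2 * K i j| ^ q) ≤ 8 * ENNReal.ofReal (∑ j, |K i j| ^ q) := by
    rw [← ENNReal.ofReal_sum_of_nonneg fun j _ => by positivity]
    rw [show (8 : ℝ≥0∞) = ENNReal.ofReal 8 by simp, ← ENNReal.ofReal_mul (by norm_num)]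
    refine ENNReal.ofReal_le_ofReal ?_
    rw [Finset.mul_sum]
    refine Finset.sum_le_sum fun j _ => ?_
    rw [abs_mul, Real.mul_rpow (abs_nonneg _) (abs_nonneg _), abs_two]
    exact mul_le_mul_of_nonneg_right h8 (by positivity)
  have hb : ENNReal.ofReal ((∑ j, (2 * K i j) ^ 2) ^ (q / 2)) ≤
      8 * ENNReal.ofReal ((∑ j, K i j ^ 2) ^ (q / 2)) := by
    rw [show (8 : ℝ≥0∞) = ENNReal.ofReal 8 by simp, ← ENNReal.ofReal_mul (by norm_num)]
    refine ENNReal.ofReal_le_ofReal ?_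
    have e : ∑ j, (2 * K i j) ^ 2 = 2 ^ (2 : ℝ) * ∑ j, K i j ^ 2 := by
      rw [Finset.mul_sum]
      exact Finset.sum_congr rfl fun j _ => by norm_num [mul_pow]
    rw [e, Real.mul_rpow (by positivity) hS, ← Real.rpow_mul (by norm_num),
      mul_div_cancel₀ _ (two_ne_zero)]
    exact mul_le_mul_of_nonneg_right h8 (by positivity)
  -- The cross-moment bound attaches an L_q contribution to ∑ |K_ij|^q. Comparing ℓ^q with ℓ² moves
  -- it to the term that carries L_q in `rowMoment`.
  have hab : ENNReal.ofReal (∑ j, |K i j| ^ q) ≤ ENNReal.ofReal ((∑ j, K i j ^ 2) ^ (q / 2)) :=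
    ENNReal.ofReal_le_ofReal (sum_abs_rpow_le_rpow_sum_sq _ _ hq.le)
  rw [← Finset.sum_mul, rowMoment]
  set a := ENNReal.ofReal (∑ j, |K i j| ^ q)
  set b := ENNReal.ofReal ((∑ j, K i j ^ 2) ^ (q / 2))
  set κ := 1 + gaussMoment q
  set S := ENNReal.ofReal (varsig ν ^ q)
  have hκ : 1 ≤ κ ^ 2 + κ := (self_le_add_right _ _ : 1 ≤ κ).trans (self_le_add_left _ _)
  -- 48 is the Rosenthal constant 6 times the bound 8 for 2^q, the 2 being the factor in the slope.
  calc _ ≤ 6 * (8 * a * (S * (momentM ν q + κ ^ 2 * momentL ν q)) +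
        8 * b * (S * (κ * momentL ν q))) := by gcongr
    _ = 48 * S * (a * momentM ν q + (a * κ ^ 2 + b * κ) * momentL ν q) := by ring
    _ ≤ 48 * S * ((κ ^ 2 + κ) * (a * momentM ν q) + (b * κ ^ 2 + b * κ) * momentL ν q) := by
        have h3 : a * momentM ν q ≤ (κ ^ 2 + κ) * (a * momentM ν q) := le_mul_of_one_le_left' hκ
        have h4 : (a * κ ^ 2 + b * κ) * momentL ν q ≤ (b * κ ^ 2 + b * κ) * momentL ν q := by
          gcongr
        exact mul_le_mul_right (add_le_add h3 h4) _
    _ = _ := by ring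

variable {K : Matrix (Fin n) (Fin n) ℝ} {F : ℝ → ℝ} {L : ℝ}

theorem ofReal_abs_integral_quadForm_swap_le (h2 : MemLp id 2 ν) (h0 : ∫ x, x ∂ν = 0)
    (hne : covMat ν ≠ 0) (hq : 2 < q) (hq3 : q ≤ 3) (hK : Kᵀ = K) (hd : ∀ i, K i i = 0)
    (hL : 0 ≤ L) (hFc : Continuous F) (hF0 : ∀ x, 0 ≤ F x) (hF1 : ∀ x, F x ≤ 1)
    (hT : HasQuadTaylor F q L) {μ μ' : Fin n → Measure (EuclideanSpace ℝ (Fin d))}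
    [∀ j, IsProbabilityMeasure (μ j)] [∀ j, IsProbabilityMeasure (μ' j)]
    (hμ : ∀ j, μ j = ν ∨ μ j = multivariateGaussian 0 (covMat ν)) (i : Fin n)
    (hi : μ i = multivariateGaussian 0 (covMat ν)) (hi' : μ' i = ν)
    (h : ∀ j, j ≠ i → μ' j = μ j) :
    ENNReal.ofReal |∫ v, F (quadForm K v) ∂(Measure.pi μ') -
      ∫ v, F (quadForm K v) ∂(Measure.pi μ)| ≤
      ENNReal.ofReal L * lindebergConst q * ENNReal.ofReal (varsig ν ^ q) * rowMoment K ν q i := by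
  have hm : Measurable fun v : Fin n → EuclideanSpace ℝ (Fin d) => F (quadForm K v) :=
    hFc.measurable.comp measurable_quadForm
  obtain ⟨hi1, e1⟩ := integral_pi_eq_integral_update (μ := μ) (μ' := μ') i h hm
    (fun v => hF0 _) (fun v => hF1 _)
  -- With both measures equal to μ, this resamples coordinate i from its own law, so both integrals
  -- share one outer measure.
  obtain ⟨hi2, e2⟩ := integral_pi_eq_integral_update (μ := μ) (μ' := μ) i (fun _ _ => rfl) hm
    (fun v => hF0 _) (fun v => hF1 _)
  have hmi : ∀ η : Measure (EuclideanSpace ℝ (Fin d)), IsProbabilityMeasure η →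
      Measurable fun v : Fin n → EuclideanSpace ℝ (Fin d) =>
        ∫⁻ x, ENNReal.ofReal (|inner ℝ x (∑ j, (2 * K i j) • v j)| ^ q) ∂η := fun η _ => by
    have : Measurable fun p : (Fin n → EuclideanSpace ℝ (Fin d)) × EuclideanSpace ℝ (Fin d) =>
      ENNReal.ofReal (|inner ℝ p.2 (∑ j, (2 * K i j) • p.1 j)| ^ q) := by fun_prop
    exact this.lintegral_prod_right'
  rw [e1, e2, ← integral_sub hi1 hi2, hi, hi', ← Real.norm_eq_abs, ofReal_norm]
  refine (enorm_integral_le_lintegral_enorm _).trans ?_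
  calc _ ≤ ∫⁻ v, ENNReal.ofReal L *
        (∫⁻ x, ENNReal.ofReal (|inner ℝ x (∑ j, (2 * K i j) • v j)| ^ q) ∂ν +
          ∫⁻ x, ENNReal.ofReal (|inner ℝ x (∑ j, (2 * K i j) • v j)| ^ q)
            ∂(multivariateGaussian 0 (covMat ν))) ∂(Measure.pi μ) := by
        refine lintegral_mono fun v => ?_
        dsimp only
        rw [← ofReal_norm, Real.norm_eq_abs]
        have e : ∀ η : Measure (EuclideanSpace ℝ (Fin d)),
            ∫ x, F (quadForm K (Function.update v i x)) ∂η =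
              ∫ x, F (quadForm K (Function.update v i 0) +
                inner ℝ x (∑ j, (2 * K i j) • v j)) ∂η := fun η =>
          integral_congr_ae (Eventually.of_forall fun x => by
            dsimp only
            rw [quadForm_update hK hd i v x])
        rw [e, e]
        exact ofReal_abs_integral_sub_integral_le hL hFc hF0 hF1 hT ν
          (multivariateGaussian 0 (covMat ν)) h2 h0 IsGaussian.memLp_two_id
          integral_id_multivariateGaussian _ _ (by
            rw [integral_inner_sq h2 h0, integral_inner_sq_gaussian h2 h0])
    _ ≤ ENNReal.ofReal L *
        (48 * ((1 + gaussMoment q) ^ 2 + (1 + gaussMoment q)) * ENNReal.ofReal (varsig ν ^ q) *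
          rowMoment K ν q i +
        48 * ((1 + gaussMoment q) ^ 2 + (1 + gaussMoment q)) * ENNReal.ofReal (varsig ν ^ q) *
          rowMoment K ν q i) := by
        have hadd := (hmi ν inferInstance).fun_add
          (hmi (multivariateGaussian 0 (covMat ν)) inferInstance)
        rw [lintegral_const_mul _ hadd, lintegral_add_left (hmi _ inferInstance)]
        gcongr
        · exact lintegral_row_rpow_le h2 h0 hne hq hq3 K (Or.inl rfl) hμ i
        · exact lintegral_row_rpow_le h2 h0 hne hq hq3 K (Or.inr rfl) hμ i
    _ = _ := by rw [lindebergConst]; ring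

/-- Lindeberg's replacement argument for quadratic forms with vanishing diagonal. -/
theorem ofReal_abs_integral_quadForm_sub_le (h2 : MemLp id 2 ν) (h0 : ∫ x, x ∂ν = 0)
    (hne : covMat ν ≠ 0) (hq : 2 < q) (hq3 : q ≤ 3) (hK : Kᵀ = K) (hd : ∀ i, K i i = 0)
    (hL : 0 ≤ L) (hFc : Continuous F) (hF0 : ∀ x, 0 ≤ F x) (hF1 : ∀ x, F x ≤ 1)
    (hT : HasQuadTaylor F q L) :
    ENNReal.ofReal |∫ v, F (quadForm K v) ∂(Measure.pi fun _ => ν) -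
        ∫ v, F (quadForm K v) ∂(Measure.pi fun _ => multivariateGaussian 0 (covMat ν))| ≤
      ENNReal.ofReal L * lindebergConst q * ENNReal.ofReal (varsig ν ^ q) *
        ∑ i, rowMoment K ν q i := by
  classical
  -- The hybrids are indexed by the set of rows that carry ν, so the replacement is an induction on
  -- finite sets and needs no ordering of the rows.
  set hyb : Finset (Fin n) → Fin n → Measure (EuclideanSpace ℝ (Fin d)) :=
    fun s j => if j ∈ s then ν else multivariateGaussian 0 (covMat ν) with hhyb
  have hprob : ∀ s j, IsProbabilityMeasure (hyb s j) := fun s j => by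
    rw [hhyb]
    dsimp only
    split_ifs <;> infer_instance
  have hor : ∀ s j, hyb s j = ν ∨ hyb s j = multivariateGaussian 0 (covMat ν) := fun s j => by
    rw [hhyb]
    dsimp only
    split_ifs <;> simp
  have key : ∀ s : Finset (Fin n),
      ENNReal.ofReal |∫ v, F (quadForm K v) ∂(Measure.pi (hyb s)) -
        ∫ v, F (quadForm K v) ∂(Measure.pi (hyb ∅))| ≤
      ENNReal.ofReal L * lindebergConst q * ENNReal.ofReal (varsig ν ^ q) *
        ∑ i ∈ s, rowMoment K ν q i := by
    intro s
    induction s using Finset.induction_on with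
    | empty => simp
    | insert a s ha ih =>
      have h1 := ofReal_abs_integral_quadForm_swap_le h2 h0 hne hq hq3 hK hd hL hFc hF0 hF1 hT
        (μ := hyb s) (μ' := hyb (insert a s)) (hor s) a (by simp [hhyb, ha]) (by simp [hhyb])
        (fun j hj => by simp [hhyb, hj])
      rw [Finset.sum_insert ha, mul_add]
      refine le_trans ?_ (add_le_add h1 ih)
      rw [← ENNReal.ofReal_add (abs_nonneg _) (abs_nonneg _)]
      exact ENNReal.ofReal_le_ofReal (abs_sub_le _ _ _)
  have := key Finset.univ
  simpa [hhyb] using this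

end Lindeberg

/-! ### Characteristic functions of weighted chi-square sums. -/

section CharFun

theorem norm_integral_cexp_sq_gaussian (s : ℝ) :
    ‖∫ x, Complex.exp (s * (x : ℂ) ^ 2 * Complex.I) ∂(gaussianReal 0 1)‖ =
      (1 + 4 * s ^ 2) ^ (-(1 / 4) : ℝ) := by
  -- Combining phase and density gives a complex Gaussian integral with parameter b, and 1 + 4s² =
  -- (2|b|)².
  set b : ℂ := 1 / 2 - s * Complex.I with hb
  have hre : 0 < b.re := by simp [hb]
  have h1 : ∀ x : ℝ, gaussianPDFReal 0 1 x • Complex.exp (s * (x : ℂ) ^ 2 * Complex.I) =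
      ((√(2 * Real.pi))⁻¹ : ℝ) * Complex.exp (-b * (x : ℂ) ^ 2) := fun x => by
    rw [gaussianPDFReal, Complex.real_smul, Complex.ofReal_mul, Complex.ofReal_exp, mul_assoc,
      ← Complex.exp_add]
    congr 2
    · simp
    · rw [hb]
      push_cast
      ring
  rw [integral_gaussianReal_eq_integral_smul one_ne_zero, integral_congr_ae
    (Eventually.of_forall h1), integral_const_mul, integral_gaussian_complex hre, norm_mul,
    Complex.norm_real, Real.norm_eq_abs, abs_of_nonneg (by positivity)]
  have e1 : ((1 / 2 : ℂ)) = ((1 / 2 : ℝ) : ℂ) := by norm_num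
  have hb0 : b ≠ 0 := fun h => by rw [h] at hre; simp at hre
  have hr : 0 < ‖b‖ := norm_pos_iff.2 hb0
  have hr2 : 1 + 4 * s ^ 2 = (2 * ‖b‖) ^ 2 := by
    rw [mul_pow, ← Complex.normSq_eq_norm_sq, Complex.normSq_apply]
    simp [hb]
    ring
  rw [e1, Complex.norm_cpow_real, norm_div, Complex.norm_real, Real.norm_eq_abs,
    abs_of_pos Real.pi_pos, hr2, ← Real.rpow_natCast, ← Real.rpow_mul (by positivity),
    ← Real.sqrt_eq_rpow]
  have e2 : ((2 : ℕ) : ℝ) * (-(1 / 4)) = -(1 / 2) := by norm_num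
  rw [e2, Real.rpow_neg (by positivity), ← Real.sqrt_eq_rpow, ← Real.sqrt_inv, ← Real.sqrt_inv,
    ← Real.sqrt_mul (by positivity)]
  congr 1
  field_simp

theorem one_add_sum_le_prod {ι : Type*} (s : Finset ι) {f : ι → ℝ} (hf : ∀ i, 0 ≤ f i) :
    1 + ∑ i ∈ s, f i ≤ ∏ i ∈ s, (1 + f i) := by
  classical
  induction s using Finset.induction_on with
  | empty => simp
  | insert a s ha ih =>
    rw [Finset.sum_insert ha, Finset.prod_insert ha]
    have h1 : 0 ≤ ∑ i ∈ s, f i := Finset.sum_nonneg fun i _ => hf i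
    nlinarith [hf a, mul_nonneg (hf a) h1, mul_le_mul_of_nonneg_left ih (hf a)]

/-- Independence gives ∏ (1 + 4t²c_k²)^(-1/4). Expanding the product only as far as 1 + ∑ keeps a
bound in terms of ∑ c_k² alone, free of the dimension. -/
theorem norm_integral_cexp_sum_sq_le {ι : Type*} [Fintype ι] (c : ι → ℝ) (t : ℝ) (ht : t ≠ 0)
    (hc : 0 < ∑ k, c k ^ 2) :
    ‖∫ x, Complex.exp (t * ((∑ k, c k * x k ^ 2 : ℝ) : ℂ) * Complex.I)
      ∂(Measure.pi fun _ : ι => gaussianReal 0 1)‖ ≤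
      (4 * t ^ 2 * ∑ k, c k ^ 2) ^ (-(1 / 4) : ℝ) := by
  have e : ∀ x : ι → ℝ, Complex.exp (t * ((∑ k, c k * x k ^ 2 : ℝ) : ℂ) * Complex.I) =
      ∏ k, Complex.exp (((t * c k : ℝ) : ℂ) * (x k : ℂ) ^ 2 * Complex.I) := fun x => by
    rw [← Complex.exp_sum]
    congr 1
    push_cast
    rw [Finset.mul_sum, Finset.sum_mul]
    exact Finset.sum_congr rfl fun k _ => by ring
  rw [integral_congr_ae (Eventually.of_forall e), integral_fintype_prod_eq_prod
    (f := fun k (y : ℝ) => Complex.exp (((t * c k : ℝ) : ℂ) * (y : ℂ) ^ 2 * Complex.I)), norm_prod]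
  simp_rw [norm_integral_cexp_sq_gaussian]
  rw [Real.finsetProd_rpow _ _ fun k _ => by positivity]
  refine Real.rpow_le_rpow_of_nonpos (by positivity) ?_ (by norm_num)
  refine le_trans ?_ (one_add_sum_le_prod Finset.univ (f := fun k => 4 * (t * c k) ^ 2)
    fun k => by positivity)
  rw [Finset.mul_sum]
  refine le_trans (le_of_eq ?_) (le_add_of_nonneg_left zero_le_one)
  exact Finset.sum_congr rfl fun k _ => by ring

end CharFun

/-! ### Diagonalizing quadratic forms of standard Gaussians. -/

section Diagonalization

variable {ι : Type*} [Fintype ι] [DecidableEq ι] {T : Matrix ι ι ℝ}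

theorem dotProduct_mulVec_eigenvector_sum (hT : T.IsHermitian) (x : ι → ℝ) :
    (∑ k, x k • hT.eigenvectorBasis k).ofLp ⬝ᵥ T *ᵥ (∑ k, x k • hT.eigenvectorBasis k).ofLp =
      ∑ k, hT.eigenvalues k * x k ^ 2 := by
  have h1 : T *ᵥ (∑ k, x k • hT.eigenvectorBasis k).ofLp =
      (∑ k, (hT.eigenvalues k * x k) • hT.eigenvectorBasis k).ofLp := by
    simp only [WithLp.ofLp_sum, WithLp.ofLp_smul, Matrix.mulVec_sum, Matrix.mulVec_smul]
    refine Finset.sum_congr rfl fun k _ => ?_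
    rw [hT.mulVec_eigenvectorBasis, smul_smul, mul_comm]
  have h2 : ∀ y z : EuclideanSpace ℝ ι, y.ofLp ⬝ᵥ z.ofLp = inner ℝ z y := fun y z => by
    rw [EuclideanSpace.inner_eq_star_dotProduct, star_trivial]
  rw [h1, h2, hT.eigenvectorBasis.orthonormal.inner_sum]
  exact Finset.sum_congr rfl fun k _ => by
    rw [conj_trivial]
    ring

/-- Each λ_k² equals |T b_k|² for the orthonormal eigenvectors b_k; Parseval is then applied to each
row of T. -/
theorem sum_eigenvalues_sq (hT : T.IsHermitian) :
    ∑ k, hT.eigenvalues k ^ 2 = ∑ i, ∑ j, T i j ^ 2 := by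
  set b := hT.eigenvectorBasis with hb
  have h1 : ∀ k, hT.eigenvalues k ^ 2 =
      ∑ i, inner ℝ (b k) (WithLp.toLp 2 (T i) : EuclideanSpace ℝ ι) ^ 2 := fun k => by
    have e1 : ‖hT.eigenvalues k • b k‖ ^ 2 = hT.eigenvalues k ^ 2 := by
      rw [norm_smul, b.orthonormal.1 k, mul_one, Real.norm_eq_abs, sq_abs]
    rw [← e1, EuclideanSpace.real_norm_sq_eq]
    refine Finset.sum_congr rfl fun i _ => ?_
    have e2 := congrFun (hT.mulVec_eigenvectorBasis k) i
    congr 1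
    refine e2.symm.trans ?_
    rw [EuclideanSpace.inner_eq_star_dotProduct, star_trivial, Matrix.mulVec]
  simp_rw [h1]
  rw [Finset.sum_comm]
  refine Finset.sum_congr rfl fun i _ => ?_
  rw [b.sum_sq_inner_right, EuclideanSpace.real_norm_sq_eq]

/-- Rotation invariance: independent standard normal coordinates give the same law in the eigenbasis
of T as in the standard basis. -/
theorem integral_quadratic_eq_integral_diagonal (hT : T.IsHermitian) (f : ℝ → ℂ)
    (hf : Measurable f) :
    ∫ x : ι → ℝ, f (x ⬝ᵥ T *ᵥ x) ∂(Measure.pi fun _ => gaussianReal 0 1) =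
      ∫ x : ι → ℝ, f (∑ k, hT.eigenvalues k * x k ^ 2) ∂(Measure.pi fun _ => gaussianReal 0 1) := by
  have h := stdGaussian_eq_map_pi_orthonormalBasis hT.eigenvectorBasis
  rw [← map_pi_eq_stdGaussian] at h
  have hm : Measurable fun y : EuclideanSpace ℝ ι => f (y.ofLp ⬝ᵥ T *ᵥ y.ofLp) := by
    refine hf.comp ?_
    simp only [dotProduct, Matrix.mulVec]
    fun_prop
  have h3 := congrArg (fun μ : Measure (EuclideanSpace ℝ ι) =>
    ∫ y, f (y.ofLp ⬝ᵥ T *ᵥ y.ofLp) ∂μ) h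
  dsimp only at h3
  rw [integral_map (by fun_prop) hm.aestronglyMeasurable,
    integral_map (Measurable.aemeasurable (by fun_prop)) hm.aestronglyMeasurable] at h3
  simp_rw [dotProduct_mulVec_eigenvector_sum hT] at h3
  exact h3

end Diagonalization

/-! ### The Gaussian quadratic form through K ⊗ Σ. -/

section GaussianForm

open scoped MatrixOrder

variable {n d : ℕ} {S : Matrix (Fin d) (Fin d) ℝ} {K : Matrix (Fin n) (Fin n) ℝ}

theorem pi_multivariateGaussian_eq_map :
    (Measure.pi fun _ : Fin n => multivariateGaussian 0 S) =
      (Measure.pi fun _ : Fin n × Fin d => gaussianReal 0 1).map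
        (fun x i => Matrix.toEuclideanCLM (𝕜 := ℝ) (CFC.sqrt S) (WithLp.toLp 2 fun k => x (i, k)))
        := by
  set g : (Fin d → ℝ) → EuclideanSpace ℝ (Fin d) :=
    fun y => Matrix.toEuclideanCLM (𝕜 := ℝ) (CFC.sqrt S) (WithLp.toLp 2 y) with hg
  have hgm : Measurable g := by fun_prop
  have h1 : multivariateGaussian 0 S = (Measure.pi fun _ : Fin d => gaussianReal 0 1).map g := by
    rw [multivariateGaussian, ← map_pi_eq_stdGaussian, Measure.map_map (by fun_prop) (by fun_prop)]
    congr 1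
    funext y
    simp [hg]
  have h2 := Measure.infinitePi_map_curry (ι := Fin n) (κ := Fin d)
    (fun _ _ => gaussianReal 0 1)
  simp only [Measure.infinitePi_eq_pi] at h2
  rw [h1, ← Measure.pi_map_pi (fun _ => hgm.aemeasurable), ← h2,
    Measure.map_map (by fun_prop) (by fun_prop)]
  rfl

theorem inner_sqrt_eq (hS : S.PosSemidef) (y z : EuclideanSpace ℝ (Fin d)) :
    inner ℝ (Matrix.toEuclideanCLM (𝕜 := ℝ) (CFC.sqrt S) y)
      (Matrix.toEuclideanCLM (𝕜 := ℝ) (CFC.sqrt S) z) = y.ofLp ⬝ᵥ S *ᵥ z.ofLp := by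
  have hsa : IsSelfAdjoint (Matrix.toEuclideanCLM (𝕜 := ℝ) (CFC.sqrt S)) :=
    (CFC.sqrt_nonneg S).isSelfAdjoint.map _
  rw [← ContinuousLinearMap.adjoint_inner_right, hsa.adjoint_eq,
    ← ContinuousLinearMap.comp_apply, ← ContinuousLinearMap.mul_def, ← map_mul,
    CFC.sqrt_mul_sqrt_self _ hS.nonneg, Matrix.inner_toEuclideanCLM]

/-- Writing each Gaussian row as Σ^(1/2) times a standard one turns the vector-valued form into a
scalar one in nd standard normals, where diagonalization applies. -/
theorem quadForm_sqrt_eq (hS : S.PosSemidef) (x : Fin n × Fin d → ℝ) :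
    quadForm K (fun i => Matrix.toEuclideanCLM (𝕜 := ℝ) (CFC.sqrt S)
      (WithLp.toLp 2 fun k => x (i, k))) = x ⬝ᵥ (Matrix.kronecker K S) *ᵥ x := by
  rw [quadForm_eq_sum]
  simp_rw [inner_sqrt_eq hS]
  simp only [dotProduct, Matrix.mulVec, Fintype.sum_prod_type, Matrix.kronecker,
    Matrix.kroneckerMap_apply, Finset.mul_sum]
  refine Finset.sum_congr rfl fun i _ => ?_
  rw [Finset.sum_comm]
  exact Finset.sum_congr rfl fun k _ => Finset.sum_congr rfl fun j _ =>
    Finset.sum_congr rfl fun l _ => by ring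

theorem norm_integral_cexp_quadForm_le (hS : S.PosSemidef) (hK : Kᵀ = K)
    (hpos : 0 < frobSq K * frobSq S) {t : ℝ} (ht : t ≠ 0) :
    ‖∫ v, Complex.exp (t * (quadForm K v : ℂ) * Complex.I)
      ∂(Measure.pi fun _ : Fin n => multivariateGaussian 0 S)‖ ≤
      (4 * t ^ 2 * (frobSq K * frobSq S)) ^ (-(1 / 4) : ℝ) := by
  have hT : (Matrix.kronecker K S).IsHermitian := by
    rw [Matrix.IsHermitian, Matrix.conjTranspose_eq_transpose_of_trivial]
    ext a b
    have h1 := congrFun (congrFun hK a.1) b.1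
    have h2 := congrFun (congrFun hS.isHermitian a.2) b.2
    rw [Matrix.transpose_apply] at h1
    rw [Matrix.conjTranspose_apply, star_trivial] at h2
    rw [Matrix.transpose_apply, Matrix.kronecker, Matrix.kroneckerMap_apply,
      Matrix.kroneckerMap_apply, h1, h2]
  have hsum : ∑ k, hT.eigenvalues k ^ 2 = frobSq K * frobSq S := by
    rw [sum_eigenvalues_sq]
    simp only [Fintype.sum_prod_type, Matrix.kronecker, Matrix.kroneckerMap_apply, mul_pow, frobSq]
    rw [Finset.sum_mul_sum]
    refine Finset.sum_congr rfl fun i _ => Finset.sum_congr rfl fun k _ => ?_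
    rw [Finset.sum_mul_sum]
  have hm : Measurable fun v : Fin n → EuclideanSpace ℝ (Fin d) =>
      Complex.exp (t * (quadForm K v : ℂ) * Complex.I) := by
    have := measurable_quadForm (K := K) (d := d)
    fun_prop
  rw [pi_multivariateGaussian_eq_map, integral_map (Measurable.aemeasurable (by fun_prop))
    hm.aestronglyMeasurable]
  simp_rw [quadForm_sqrt_eq hS]
  rw [integral_quadratic_eq_integral_diagonal hT (fun r => Complex.exp (t * (r : ℂ) * Complex.I))
    (by fun_prop), ← hsum]
  exact norm_integral_cexp_sum_sq_le _ t ht (hsum ▸ hpos)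

end GaussianForm

/-! ### Small ball probabilities from decay of the characteristic function. -/

section SmallBall

/-- The moment of order `-1/2` of the standard normal distribution. -/
noncomputable def gaussNegMoment : ℝ≥0∞ :=
  ∫⁻ t, ENNReal.ofReal (|t| ^ (-(1 / 2) : ℝ)) ∂(gaussianReal 0 1)

theorem gaussNegMoment_ne_top : gaussNegMoment ≠ ∞ := by
  set f : ℝ → ℝ := fun t => |t| ^ (-(1 / 2) : ℝ) with hf
  set g : ℝ → ℝ := fun t => |t| ^ (-(1 / 2) : ℝ) * Real.exp (-(1 / 2) * t ^ 2) with hg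
  have h0 : IntegrableOn g (Set.Ioi 0) := by
    refine (integrable_rpow_mul_exp_neg_mul_sq (b := 1 / 2) (by norm_num)
      (s := -(1 / 2)) (by norm_num)).integrableOn.congr_fun (fun x hx => ?_) measurableSet_Ioi
    rw [hg]
    dsimp only
    rw [abs_of_pos (Set.mem_Ioi.1 hx)]
  have h1 : IntegrableOn g (Set.Iic 0) := by
    rw [← Measure.map_neg_eq_self (volume : Measure ℝ)]
    let m : MeasurableEmbedding fun x : ℝ => -x := (Homeomorph.neg ℝ).measurableEmbedding
    rw [m.integrableOn_map_iff]
    simp only [hg, Function.comp_def, abs_neg, neg_sq, Set.neg_preimage, Set.neg_Iic, neg_zero]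
    exact Iff.mpr integrableOn_Ici_iff_integrableOn_Ioi h0
  have h2 : Integrable g := by
    rw [← integrableOn_univ, ← Set.Iic_union_Ioi (a := (0 : ℝ))]
    exact h1.union h0
  have h3 : Integrable f (gaussianReal 0 1) := by
    rw [gaussianReal_of_var_ne_zero _ one_ne_zero,
      integrable_withDensity_iff_integrable_smul' (measurable_gaussianPDF _ _)
        (Eventually.of_forall fun _ => gaussianPDF_lt_top)]
    refine (h2.const_mul (√(2 * Real.pi))⁻¹).congr (Eventually.of_forall fun t => ?_)
    simp only [toReal_gaussianPDF, gaussianPDFReal, smul_eq_mul, hf, hg, NNReal.coe_one, mul_one,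
      sub_zero]
    rw [show -(1 / 2) * t ^ 2 = -t ^ 2 / 2 by ring]
    ring
  exact (lintegral_ofReal_ne_top_iff_integrable h3.1
    (Eventually.of_forall fun t => by positivity)).2 h3

variable {Ω : Type*} [MeasurableSpace Ω] {μ : Measure Ω} [IsProbabilityMeasure μ]

/-- Esseen's small ball inequality with a Gaussian kernel, for characteristic functions that decay
like `|t| ^ (-1/2)`. -/
theorem measure_abs_sub_le_le {G : Ω → ℝ} (hG : Measurable G) {B : ℝ} (hB : 0 ≤ B)
    (hφ : ∀ t : ℝ, t ≠ 0 → ‖∫ ω, Complex.exp (t * (G ω : ℂ) * Complex.I) ∂μ‖ ≤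
      B * |t| ^ (-(1 / 2) : ℝ)) (z : ℝ) {ε : ℝ} (hε : 0 < ε) :
    μ {ω | |G ω - z| ≤ ε} ≤
      ENNReal.ofReal (Real.exp (1 / 2) * B * ε ^ (1 / 2 : ℝ)) * gaussNegMoment := by
  -- A Gaussian bump of width ε around z: it is at least exp(-1/2) on the ball, which gives the
  -- factor exp(1/2).
  set E : Ω → ℝ := fun ω => Real.exp (-((G ω - z) / ε) ^ 2 / 2) with hE
  have hEm : Measurable E := by fun_prop
  have hE1 : ∀ ω, E ω ≤ 1 := fun ω => by
    rw [hE]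
    refine Real.exp_le_one_iff.2 ?_
    have := sq_nonneg ((G ω - z) / ε)
    linarith
  have hEi : Integrable E μ := by
    refine Integrable.of_bound (C := 1) hEm.aestronglyMeasurable (Eventually.of_forall fun ω => ?_)
    rw [Real.norm_eq_abs, abs_of_pos (Real.exp_pos _)]
    exact hE1 ω
  have hMarkov : μ {ω | |G ω - z| ≤ ε} ≤
      ENNReal.ofReal (Real.exp (1 / 2)) * ∫⁻ ω, ENNReal.ofReal (E ω) ∂μ := by
    rw [← lintegral_const_mul _ (by fun_prop), ← lintegral_indicator_one
      (measurableSet_le (by fun_prop) measurable_const)]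
    refine lintegral_mono fun ω => ?_
    by_cases hω : ω ∈ {ω | |G ω - z| ≤ ε}
    · rw [Set.indicator_of_mem hω, Pi.one_apply, ← ENNReal.ofReal_mul (Real.exp_pos _).le,
        ← Real.exp_add, ENNReal.one_le_ofReal, Real.one_le_exp_iff]
      have h1 : |(G ω - z) / ε| ≤ 1 := by
        rw [abs_div, abs_of_pos hε, div_le_one hε]
        exact hω
      have h2 : ((G ω - z) / ε) ^ 2 ≤ 1 := (sq_le_one_iff_abs_le_one _).2 h1
      linarith
    · rw [Set.indicator_of_notMem hω]
      exact zero_le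
  refine hMarkov.trans ?_
  rw [mul_assoc, ENNReal.ofReal_mul (Real.exp_pos _).le, mul_assoc]
  refine mul_le_mul_right ?_ _
  have hm : Measurable fun p : Ω × ℝ =>
      Complex.exp ((p.2 : ℂ) * ((G p.1 - z) / ε : ℝ) * Complex.I) := by
    fun_prop
  have hint : Integrable (fun p : Ω × ℝ =>
      Complex.exp ((p.2 : ℂ) * ((G p.1 - z) / ε : ℝ) * Complex.I))
      (μ.prod (gaussianReal 0 1)) := by
    refine Integrable.of_bound (C := 1) hm.aestronglyMeasurable (Eventually.of_forall fun p => ?_)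
    rw [← Complex.ofReal_mul, Complex.norm_exp_ofReal_mul_I]
  -- The bump is the characteristic function of N(0,1) at (G - z)/ε, so by Fubini its mean is a
  -- Gaussian average of that of G at t/ε, up to a phase.
  have hEc : ((∫ ω, E ω ∂μ : ℝ) : ℂ) =
      ∫ t, ∫ ω, Complex.exp ((t : ℂ) * ((G ω - z) / ε : ℝ) * Complex.I) ∂μ ∂(gaussianReal 0 1) := by
    rw [← integral_integral_swap hint, ← integral_complex_ofReal]
    refine integral_congr_ae (Eventually.of_forall fun ω => ?_)
    dsimp only
    have h := charFun_gaussianReal (μ := 0) (v := 1) ((G ω - z) / ε)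
    rw [charFun_apply_real] at h
    rw [show (∫ t : ℝ, Complex.exp ((t : ℂ) * ((G ω - z) / ε : ℝ) * Complex.I)
      ∂(gaussianReal 0 1)) =
      ∫ t : ℝ, Complex.exp ((((G ω - z) / ε : ℝ) : ℂ) * t * Complex.I) ∂(gaussianReal 0 1) from by
        simp only [mul_comm], h, hE]
    push_cast
    congr 1
    simp
    ring
  rw [← ofReal_integral_eq_lintegral_ofReal hEi (Eventually.of_forall fun ω => (Real.exp_pos _).le)]
  have h1 : ENNReal.ofReal (∫ ω, E ω ∂μ) = ‖((∫ ω, E ω ∂μ : ℝ) : ℂ)‖ₑ := by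
    rw [← ofReal_norm, Complex.norm_real, Real.norm_eq_abs,
      abs_of_nonneg (integral_nonneg fun ω => (Real.exp_pos _).le)]
  rw [h1, hEc, gaussNegMoment, ← lintegral_const_mul _ (by fun_prop)]
  refine (enorm_integral_le_lintegral_enorm _).trans (lintegral_mono_ae ?_)
  have hne : ∀ᵐ t ∂(gaussianReal 0 1), t ≠ 0 := by
    have := nullSingletonClass_gaussianReal (μ := 0) (v := 1) one_ne_zero
    exact Measure.ae_ne _ 0
  filter_upwards [hne] with t ht
  have h2 : ∫ ω, Complex.exp ((t : ℂ) * ((G ω - z) / ε : ℝ) * Complex.I) ∂μ =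
      Complex.exp (((-(t * z / ε) : ℝ) : ℂ) * Complex.I) *
        ∫ ω, Complex.exp (((t / ε : ℝ) : ℂ) * (G ω : ℂ) * Complex.I) ∂μ := by
    rw [← integral_const_mul]
    refine integral_congr_ae (Eventually.of_forall fun ω => ?_)
    dsimp only
    rw [← Complex.exp_add]
    congr 1
    push_cast
    ring
  rw [h2, ← ofReal_norm, norm_mul, Complex.norm_exp_ofReal_mul_I, one_mul,
    ← ENNReal.ofReal_mul (by positivity)]
  refine ENNReal.ofReal_le_ofReal ((hφ (t / ε) (div_ne_zero ht hε.ne')).trans_eq ?_)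
  rw [abs_div, abs_of_pos hε, Real.div_rpow (abs_nonneg _) hε.le, Real.rpow_neg hε.le]
  field_simp

end SmallBall

/-! ### From smooth test functions to the Kolmogorov distance. -/

section Smoothing

variable {Ω Ω' : Type*} [MeasurableSpace Ω] [MeasurableSpace Ω'] {P : Measure Ω} {P' : Measure Ω'}
  {S : Ω → ℝ} {T : Ω' → ℝ}

theorem kolmogorovDist_nonneg : 0 ≤ kolmogorovDist P S P' T :=
  Real.iSup_nonneg fun _ => abs_nonneg _

variable [IsProbabilityMeasure P] [IsProbabilityMeasure P']

theorem kolmogorovDist_le_one : kolmogorovDist P S P' T ≤ 1 :=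
  ciSup_le fun z => by
    have h1 : P.real {ω | S ω ≤ z} ≤ 1 := measureReal_le_one
    have h2 : P'.real {ω | T ω ≤ z} ≤ 1 := measureReal_le_one
    rw [abs_le]
    constructor <;> linarith [measureReal_nonneg (μ := P) (s := {ω | S ω ≤ z}),
      measureReal_nonneg (μ := P') (s := {ω | T ω ≤ z})]

theorem measureReal_le_integral_of_one {F : ℝ → ℝ} (hS : Measurable S) (hFc : Continuous F)
    (hF0 : ∀ x, 0 ≤ F x) (hF1 : ∀ x, F x ≤ 1) {z : ℝ} (hF : ∀ x ≤ z, F x = 1) :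
    P.real {ω | S ω ≤ z} ≤ ∫ ω, F (S ω) ∂P := by
  have hms : MeasurableSet {ω | S ω ≤ z} := measurableSet_le hS measurable_const
  rw [← integral_indicator_one hms]
  refine integral_mono ((integrable_const (1 : ℝ)).indicator hms) ?_ fun ω => ?_
  · refine Integrable.of_bound (C := 1) (hFc.measurable.comp hS).aestronglyMeasurable
      (Eventually.of_forall fun ω => ?_)
    rw [Real.norm_eq_abs, abs_of_nonneg (hF0 _)]
    exact hF1 _
  · by_cases h : ω ∈ {ω | S ω ≤ z}
    · rw [Set.indicator_of_mem h, hF _ h, Pi.one_apply]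
    · rw [Set.indicator_of_notMem h]
      exact hF0 _

theorem integral_le_measureReal_of_zero {F : ℝ → ℝ} (hS : Measurable S) (hFc : Continuous F)
    (hF0 : ∀ x, 0 ≤ F x) (hF1 : ∀ x, F x ≤ 1) {z : ℝ} (hF : ∀ x, z ≤ x → F x = 0) :
    ∫ ω, F (S ω) ∂P ≤ P.real {ω | S ω ≤ z} := by
  have hms : MeasurableSet {ω | S ω ≤ z} := measurableSet_le hS measurable_const
  rw [← integral_indicator_one hms]
  refine integral_mono ?_ ((integrable_const (1 : ℝ)).indicator hms) fun ω => ?_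
  · refine Integrable.of_bound (C := 1) (hFc.measurable.comp hS).aestronglyMeasurable
      (Eventually.of_forall fun ω => ?_)
    rw [Real.norm_eq_abs, abs_of_nonneg (hF0 _)]
    exact hF1 _
  · by_cases h : ω ∈ {ω | S ω ≤ z}
    · rw [Set.indicator_of_mem h, Pi.one_apply]
      exact hF1 _
    · rw [Set.indicator_of_notMem h, hF _ (le_of_lt (not_le.1 h))]

/-- Smoothing: a bound for smooth test functions and a small ball bound for one of the variables
give a bound for the Kolmogorov distance. -/
theorem ofReal_kolmogorovDist_le (hS : Measurable S) (hT : Measurable T) {χ : ℝ → ℝ}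
    (hχc : Continuous χ) (hχ0 : ∀ x, 0 ≤ χ x) (hχ1 : ∀ x, χ x ≤ 1) (hχl : ∀ x ≤ 0, χ x = 1)
    (hχr : ∀ x, 1 ≤ x → χ x = 0) {ε : ℝ} (hε : 0 < ε) {e b : ℝ≥0∞}
    (hL : ∀ z, ENNReal.ofReal |∫ ω, χ ((S ω - z) / ε) ∂P - ∫ ω, χ ((T ω - z) / ε) ∂P'| ≤ e)
    (hb : ∀ z, P' {ω | |T ω - z| ≤ ε} ≤ b) :
    ENNReal.ofReal (kolmogorovDist P S P' T) ≤ e + b := by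
  by_cases htop : e + b = ∞
  · rw [htop]; exact le_top
  obtain ⟨he, hbt⟩ := ENNReal.add_ne_top.1 htop
  have hL' : ∀ z, |∫ ω, χ ((S ω - z) / ε) ∂P - ∫ ω, χ ((T ω - z) / ε) ∂P'| ≤ e.toReal := fun z =>
    (ENNReal.ofReal_le_iff_le_toReal he).1 (hL z)
  have hb' : ∀ z, P'.real {ω | |T ω - z| ≤ ε} ≤ b.toReal := fun z => ENNReal.toReal_mono hbt (hb z)
  rw [ENNReal.ofReal_le_iff_le_toReal htop, ENNReal.toReal_add he hbt]
  refine ciSup_le fun z => ?_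
  have hc : ∀ z, Continuous fun t : ℝ => χ ((t - z) / ε) := fun z => by fun_prop
  have hone : ∀ z, ∀ x ≤ z, χ ((x - z) / ε) = 1 := fun z x hx =>
    hχl _ (div_nonpos_of_nonpos_of_nonneg (by linarith) hε.le)
  have hzero : ∀ z x, z + ε ≤ x → χ ((x - z) / ε) = 0 := fun z x hx =>
    hχr _ ((one_le_div hε).2 (by linarith))
  have hS1 := measureReal_le_integral_of_one (P := P) hS (hc z) (fun _ => hχ0 _) (fun _ => hχ1 _)
    (hone z)
  have hT1 := integral_le_measureReal_of_zero (P := P') hT (hc z) (fun _ => hχ0 _) (fun _ => hχ1 _)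
    (hzero z)
  -- The cutoff started at z bounds the distribution function of S from above, the one started at z
  -- - ε from below; the error from the transition zone falls on T only.
  have hS2 := integral_le_measureReal_of_zero (P := P) (z := z) hS (hc (z - ε)) (fun _ => hχ0 _)
    (fun _ => hχ1 _) (fun x hx => hzero (z - ε) x (by linarith))
  have hT2 := measureReal_le_integral_of_one (P := P') hT (hc (z - ε)) (fun _ => hχ0 _)
    (fun _ => hχ1 _) (hone (z - ε))
  have hu1 : P'.real {ω | T ω ≤ z + ε} ≤
      P'.real {ω | T ω ≤ z} + P'.real {ω | |T ω - z| ≤ ε} := by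
    refine (measureReal_mono fun ω (hω : T ω ≤ z + ε) => ?_).trans (measureReal_union_le _ _)
    rcases le_or_gt (T ω) z with h | h
    · exact Or.inl h
    · refine Or.inr ?_
      rw [Set.mem_ofPred_eq, abs_le]
      constructor <;> linarith
  have hu2 : P'.real {ω | T ω ≤ z} ≤
      P'.real {ω | T ω ≤ z - ε} + P'.real {ω | |T ω - z| ≤ ε} := by
    refine (measureReal_mono fun ω (hω : T ω ≤ z) => ?_).trans (measureReal_union_le _ _)
    rcases le_or_gt (T ω) (z - ε) with h | h
    · exact Or.inl h
    · refine Or.inr ?_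
      rw [Set.mem_ofPred_eq, abs_le]
      constructor <;> linarith
  have l1 := abs_le.1 (hL' z)
  have l2 := abs_le.1 (hL' (z - ε))
  have l3 := hb' z
  rw [abs_le]
  constructor <;> linarith

end Smoothing

/-! ### Choice of the smoothing parameter. -/

section Optimization

theorem le_mul_rpow_of_forall_le {r c₀ : ℝ} {c₁ D : ℝ≥0∞} {q : ℝ} (hq : 0 < q) (hc₀ : 0 ≤ c₀)
    (hc₁ : c₁ ≠ ∞) (h : ∀ η : ℝ, 0 < η → ENNReal.ofReal r ≤
      ENNReal.ofReal (c₀ * η ^ (1 / 2 : ℝ)) + ENNReal.ofReal (η ^ (-q)) * c₁ * D) :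
    ENNReal.ofReal r ≤ ENNReal.ofReal (c₀ + c₁.toReal + 1) * D ^ (1 / (2 * q + 1)) := by
  have hc1 : 0 ≤ c₁.toReal := ENNReal.toReal_nonneg
  have hpos : 0 < 1 / (2 * q + 1) := by positivity
  by_cases hDt : D = ∞
  · rw [hDt, ENNReal.top_rpow_of_pos hpos, ENNReal.mul_top]
    · exact le_top
    · rw [Ne, ENNReal.ofReal_eq_zero, not_le]
      positivity
  by_cases hD0 : D = 0
  · rw [hD0] at h ⊢
    have h0 : r ≤ 0 := by
      refine le_of_forall_pos_le_add fun ε hε => ?_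
      -- For D = 0 there is nothing to balance: let η tend to zero, here with c₀ η^(1/2) ≤ ε.
      have h1 := h ((ε / (c₀ + 1)) ^ 2) (by positivity)
      rw [mul_zero, add_zero, ← Real.sqrt_eq_rpow, Real.sqrt_sq (by positivity)] at h1
      have h2 := (ENNReal.ofReal_le_ofReal_iff (by positivity)).1 h1
      refine h2.trans ?_
      rw [zero_add, mul_div_assoc', div_le_iff₀ (by positivity)]
      nlinarith
    rw [ENNReal.ofReal_of_nonpos h0]
    exact zero_le
  set δ := D.toReal with hδ
  have hδ0 : 0 < δ := ENNReal.toReal_pos hD0 hDt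
  have hDδ : D = ENNReal.ofReal δ := (ENNReal.ofReal_toReal hDt).symm
  -- This η solves η^(1/2) = η^(-q) δ.
  have h1 := h (δ ^ (2 / (2 * q + 1))) (by positivity)
  have e1 : (δ ^ (2 / (2 * q + 1))) ^ (1 / 2 : ℝ) = δ ^ (1 / (2 * q + 1)) := by
    rw [← Real.rpow_mul hδ0.le]
    congr 1
    ring
  have e2 : (δ ^ (2 / (2 * q + 1))) ^ (-q) * δ = δ ^ (1 / (2 * q + 1)) := by
    rw [← Real.rpow_mul hδ0.le, ← Real.rpow_add_one hδ0.ne']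
    congr 1
    field_simp
    ring
  have e3 : ENNReal.ofReal ((δ ^ (2 / (2 * q + 1))) ^ (-q)) * c₁ * D =
      ENNReal.ofReal (c₁.toReal * δ ^ (1 / (2 * q + 1))) := by
    nth_rewrite 1 [← ENNReal.ofReal_toReal hc₁]
    rw [hDδ, ← ENNReal.ofReal_mul (by positivity), ← ENNReal.ofReal_mul (by positivity), ← e2]
    congr 1
    ring
  rw [e1, e3, ← ENNReal.ofReal_add (by positivity) (by positivity)] at h1
  refine h1.trans ?_
  rw [hDδ, ENNReal.ofReal_rpow_of_pos hδ0, ← ENNReal.ofReal_mul (by positivity)]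
  refine ENNReal.ofReal_le_ofReal ?_
  have : 0 ≤ δ ^ (1 / (2 * q + 1)) := by positivity
  nlinarith

end Optimization

/-! ### Assembly for the regression model. -/

namespace RegressionModel

variable (M : RegressionModel.{u})

theorem isProbabilityMeasure_law : IsProbabilityMeasure M.law := by
  have hn : 0 < M.n := by
    have := M.one_le_m
    have := M.m_le_p
    have := M.p_lt_n
    omega
  rw [← (M.hasLaw ⟨0, hn⟩).map_eq]
  exact Measure.isProbabilityMeasure_map (M.hasLaw ⟨0, hn⟩).aemeasurable

theorem map_V_eq_pi : M.prob.map (fun ω i => M.V i ω) = Measure.pi fun _ => M.law := by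
  have := M.isProbabilityMeasure_law
  rw [M.indep.map_fun_eq_pi_map fun i => (M.hasLaw i).aemeasurable]
  simp_rw [(M.hasLaw _).map_eq]

variable {M}

theorem U_eq_quadForm (hN : M.Null) (ω : M.Ω) : M.U ω = quadForm M.Pθ fun i => M.V i ω :=
  statU_add_eq M.X M.C M.rank_X M.rank_C hN _

theorem rho_eq (hN : M.Null) :
    M.rho = kolmogorovDist (Measure.pi fun _ => M.law) (quadForm M.Pθ) M.gaussLaw
      (quadForm M.Pθ) := by
  have hU : M.U = quadForm M.Pθ ∘ fun ω i => M.V i ω := funext fun ω => U_eq_quadForm hN ω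
  have haem : AEMeasurable (fun ω i => M.V i ω) M.prob :=
    aemeasurable_pi_lambda _ fun i => (M.hasLaw i).aemeasurable
  rw [rho, kolmogorovDist, kolmogorovDist]
  congr 1
  funext z
  rw [← M.map_V_eq_pi, map_measureReal_apply_of_aemeasurable haem
    (measurableSet_le measurable_quadForm measurable_const), hU]
  rfl

theorem sum_rowMoment_eq {w : ℝ} (hw : w < 1 / 2) (hd : ∀ i, M.P0 i i ≤ w) {q : ℝ} (hq : 2 < q) :
    ∑ i, rowMoment M.Pθ M.law q i = ENNReal.ofReal ((M.m : ℝ) ^ (q / 2)) * M.Delta q := by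
  have hdiag : ∀ i, M.Pθ i i = 0 := fun i => Ptheta_diag M.X M.C M.rank_X M.rank_C hw hd i
  have hm : (0 : ℝ) < (M.m : ℝ) ^ (q / 2) :=
    Real.rpow_pos_of_pos (by exact_mod_cast M.one_le_m) _
  have e1 : ∀ i, ∑ j with j ≠ i, |M.Pθ i j| ^ q = ∑ j, |M.Pθ i j| ^ q := fun i => by
    refine Finset.sum_filter_of_ne fun j _ hj => ?_
    rintro rfl
    rw [hdiag, abs_zero, Real.zero_rpow (by linarith)] at hj
    exact hj rfl
  have e2 : ∀ i, ∑ j with j ≠ i, M.Pθ i j ^ 2 = ∑ j, M.Pθ i j ^ 2 := fun i => by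
    refine Finset.sum_filter_of_ne fun j _ hj => ?_
    rintro rfl
    rw [hdiag, sq, mul_zero] at hj
    exact hj rfl
  simp only [Delta, e1, e2, rowMoment]
  rw [mul_add, ← mul_assoc, ← mul_assoc, ← ENNReal.ofReal_mul hm.le, ← ENNReal.ofReal_mul hm.le,
    mul_div_cancel₀ _ hm.ne', mul_div_cancel₀ _ hm.ne', Finset.sum_add_distrib, ← Finset.sum_mul,
    ← Finset.sum_mul, ENNReal.ofReal_sum_of_nonneg fun i _ => Finset.sum_nonneg fun j _ => by
      positivity, ENNReal.ofReal_sum_of_nonneg fun i _ => by positivity]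

/-- The threshold on the imbalance is the one at which θ·diag P ≤ m/2, so the Gaussian form cannot
degenerate. -/
theorem half_le_frobSq {w : ℝ} (hw : w < 1 / 2) (hd : ∀ i, M.P0 i i ≤ w)
    (himb : M.imbalance ≤ (1 - w) * (1 - 2 * w) / 2) : (M.m : ℝ) / 2 ≤ frobSq M.Pθ := by
  have hc : 0 < (1 - w) * (1 - 2 * w) := by apply mul_pos <;> linarith
  have hm : (0 : ℝ) < M.m := by exact_mod_cast M.one_le_m
  have h1 := frobSq_Ptheta M.X M.C M.rank_X M.rank_C hw hd
  have h2 := theta_dotProduct_le M.X M.C M.rank_X M.rank_C hw hd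
  rw [imbalance, div_le_iff₀ hm] at himb
  have h3 : (∑ i, projP M.X M.C i i ^ 2) / ((1 - w) * (1 - 2 * w)) ≤ M.m / 2 := by
    rw [div_le_iff₀ hc]
    refine himb.trans_eq ?_
    ring
  change _ ≤ frobSq (Ptheta M.X M.C)
  linarith

/-- The basic inequality with a free smoothing parameter `η`. -/
theorem ofReal_rho_le {w : ℝ} (hw : w < 1 / 2) (hd : ∀ i, M.P0 i i ≤ w) (hN : M.Null)
    (himb : M.imbalance ≤ (1 - w) * (1 - 2 * w) / 2) {q : ℝ} (hq : 2 < q) (hq3 : q ≤ 3)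
    {χ : ℝ → ℝ} {L : ℝ} (hL : 0 ≤ L) (hχc : Continuous χ) (hχ0 : ∀ x, 0 ≤ χ x)
    (hχ1 : ∀ x, χ x ≤ 1) (hχl : ∀ x ≤ 0, χ x = 1) (hχr : ∀ x, 1 ≤ x → χ x = 0)
    (hχT : HasQuadTaylor χ q L) {η : ℝ} (hη : 0 < η) :
    ENNReal.ofReal M.rho ≤
      ENNReal.ofReal (Real.exp (1 / 2) * gaussNegMoment.toReal * η ^ (1 / 2 : ℝ)) +
        ENNReal.ofReal (η ^ (-q)) * (ENNReal.ofReal L * lindebergConst q) * M.Delta q := by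
  have := M.isProbabilityMeasure_law
  have : IsProbabilityMeasure M.gaussLaw := by rw [gaussLaw]; infer_instance
  have hς := varsig_pos M.cov_ne_zero
  have hm : (0 : ℝ) < M.m := by exact_mod_cast M.one_le_m
  set K := M.Pθ with hKdef
  have hK : Kᵀ = K := Ptheta_transpose M.X M.C
  have hdiag : ∀ i, K i i = 0 := fun i => Ptheta_diag M.X M.C M.rank_X M.rank_C hw hd i
  set τ := √M.m * varsig M.law with hτdef
  have hτ : 0 < τ := mul_pos (Real.sqrt_pos.2 hm) hς
  have hε : 0 < η * τ := mul_pos hη hτ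
  have hfrob : frobSq (covMat M.law) = varsig M.law ^ 2 := by
    rw [varsig, Real.sq_sqrt]
    exact Finset.sum_nonneg fun i _ => Finset.sum_nonneg fun j _ => sq_nonneg _
  have hprod : τ ^ 2 / 2 ≤ frobSq K * frobSq (covMat M.law) := by
    rw [hfrob, hτdef, mul_pow, Real.sq_sqrt hm.le, mul_div_right_comm]
    exact mul_le_mul_of_nonneg_right (half_le_frobSq hw hd himb) (sq_nonneg _)
  have hsmall : ∀ z, M.gaussLaw {v | |quadForm K v - z| ≤ η * τ} ≤
      ENNReal.ofReal (Real.exp (1 / 2) * gaussNegMoment.toReal * η ^ (1 / 2 : ℝ)) := by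
    intro z
    refine (measure_abs_sub_le_le (μ := M.gaussLaw) measurable_quadForm (B := τ ^ (-(1 / 2) : ℝ))
      (by positivity) (fun t ht => ?_) z hε).trans ?_
    · refine (norm_integral_cexp_quadForm_le (posSemidef_covMat M.memLp_two M.mean_zero) hK
        (lt_of_lt_of_le (by positivity) hprod) ht).trans ?_
      have h1 : (τ * |t|) ^ 2 ≤ 4 * t ^ 2 * (frobSq K * frobSq (covMat M.law)) := by
        rw [mul_pow, sq_abs]
        nlinarith [sq_nonneg t, mul_le_mul_of_nonneg_left hprod (sq_nonneg t),
          mul_nonneg (sq_nonneg t) (sq_nonneg τ)]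
      have h2 : 0 < τ * |t| := mul_pos hτ (abs_pos.2 ht)
      refine (Real.rpow_le_rpow_of_nonpos (by positivity) h1 (by norm_num)).trans_eq ?_
      rw [← Real.rpow_natCast, ← Real.rpow_mul h2.le, ← Real.mul_rpow hτ.le (abs_nonneg t)]
      norm_num
    · rw [← ENNReal.ofReal_toReal gaussNegMoment_ne_top, ← ENNReal.ofReal_mul (by positivity),
        ENNReal.toReal_ofReal ENNReal.toReal_nonneg]
      refine ENNReal.ofReal_le_ofReal (le_of_eq ?_)
      rw [Real.mul_rpow hη.le hτ.le, Real.rpow_neg hτ.le]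
      have : τ ^ (1 / 2 : ℝ) ≠ 0 := (Real.rpow_pos_of_pos hτ _).ne'
      field_simp
  have hlind : ∀ z, ENNReal.ofReal |∫ v, χ ((quadForm K v - z) / (η * τ))
      ∂(Measure.pi fun _ => M.law) - ∫ v, χ ((quadForm K v - z) / (η * τ)) ∂M.gaussLaw| ≤
      ENNReal.ofReal (η ^ (-q)) * (ENNReal.ofReal L * lindebergConst q) * M.Delta q := by
    intro z
    refine (ofReal_abs_integral_quadForm_sub_le (F := fun t => χ ((t - z) / (η * τ))) M.memLp_two
      M.mean_zero M.cov_ne_zero hq hq3 hK hdiag (L := L * (η * τ) ^ (-q)) (by positivity)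
      (by fun_prop) (fun _ => hχ0 _) (fun _ => hχ1 _) (hχT.comp_sub_div z hε)).trans_eq ?_
    rw [sum_rowMoment_eq hw hd hq]
    -- The choice of τ makes ε^(-q) cancel ς^q from the moments and m^(q/2) from the normalization
    -- of Δ.
    have e : (η * τ) ^ (-q) = η ^ (-q) * ((varsig M.law ^ q)⁻¹ * ((M.m : ℝ) ^ (q / 2))⁻¹) := by
      rw [Real.mul_rpow hη.le hτ.le, hτdef, Real.mul_rpow (Real.sqrt_nonneg _) hς.le,
        Real.sqrt_eq_rpow, ← Real.rpow_mul hm.le, Real.rpow_neg hς.le,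
        show 1 / 2 * -q = -(q / 2) by ring, Real.rpow_neg hm.le]
      ring
    have h1 : varsig M.law ^ q ≠ 0 := (Real.rpow_pos_of_pos hς _).ne'
    have h2 : (M.m : ℝ) ^ (q / 2) ≠ 0 := (Real.rpow_pos_of_pos hm _).ne'
    calc _ = ENNReal.ofReal (L * (η * τ) ^ (-q)) * ENNReal.ofReal (varsig M.law ^ q) *
          ENNReal.ofReal ((M.m : ℝ) ^ (q / 2)) * lindebergConst q * M.Delta q := by ring
      _ = ENNReal.ofReal (η ^ (-q) * L) * lindebergConst q * M.Delta q := by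
          rw [← ENNReal.ofReal_mul (by positivity), ← ENNReal.ofReal_mul (by positivity), e]
          congr 3
          field_simp
      _ = _ := by
          rw [ENNReal.ofReal_mul (by positivity)]
          ring
  rw [rho_eq hN, add_comm]
  exact ofReal_kolmogorovDist_le measurable_quadForm measurable_quadForm hχc hχ0 hχ1 hχl hχr hε
    hlind hsmall

theorem tendsto_bound {M : ℕ → RegressionModel.{u}} {q : ℝ} (hq : 0 < q) (cq c : ℝ)
    (himb : Tendsto (fun k => (M k).imbalance) atTop (𝓝 0))
    (hΔ : Tendsto (fun k => (M k).Delta q) atTop (𝓝 0)) :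
    Tendsto (fun k => (M k).bound q cq c) atTop (𝓝 0) := by
  have h1 : Tendsto (fun k => ENNReal.ofReal cq * (M k).Delta q ^ (1 / (2 * q + 1))) atTop
      (𝓝 0) := by
    have hpos : 0 < 1 / (2 * q + 1) := by positivity
    have h := (ENNReal.continuous_rpow_const (y := 1 / (2 * q + 1))).tendsto 0 |>.comp hΔ
    rw [ENNReal.zero_rpow_of_pos hpos] at h
    have := ENNReal.Tendsto.const_mul (a := ENNReal.ofReal cq) h (Or.inr ENNReal.ofReal_ne_top)
    rwa [mul_zero] at this
  have h2 : Tendsto (fun k => ENNReal.ofReal (c * (M k).imbalance ^ (1 / 5 : ℝ))) atTop (𝓝 0) := by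
    have h := ((Real.continuous_rpow_const (q := (1 / 5 : ℝ)) (by norm_num)).tendsto 0).comp himb
    rw [Real.zero_rpow (by norm_num)] at h
    have := ENNReal.tendsto_ofReal (h.const_mul c)
    rwa [mul_zero, ENNReal.ofReal_zero] at this
  simpa [bound] using h1.add h2

end RegressionModel

end ManovaU

/-! ### The main theorem. -/

theorem theorem2 :
    ∃ Cq C : ℝ → ℝ, (∀ q, 0 < Cq q) ∧ (∀ w, 0 < C w) ∧
      ∀ q : ℝ, 2 < q → q ≤ 3 → ∀ w : ℝ, 0 < w → w < 1 / 2 →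
        (∀ M : ManovaU.RegressionModel.{u}, (∀ i, M.P0 i i ≤ w) → M.Null →
          (∀ i, M.Pθ i i = 0) ∧
          (∀ ω, M.U ω = ManovaU.quadForm M.Pθ (fun i => M.V i ω)) ∧
          ENNReal.ofReal M.rho ≤ M.bound q (Cq q) (C w)) ∧
        (∀ M : ℕ → ManovaU.RegressionModel.{u}, (∀ k i, (M k).P0 i i ≤ w) → (∀ k, (M k).Null) →
          Tendsto (fun k => (M k).imbalance) atTop (𝓝 0) →
          Tendsto (fun k => (M k).Delta q) atTop (𝓝 0) →
          Tendsto (fun k => (M k).bound q (Cq q) (C w)) atTop (𝓝 0) ∧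
          Tendsto (fun k => (M k).rho) atTop (𝓝 0)) := by
  obtain ⟨χ, χ', χ'', L, hL, hχc, hχ0, hχ1, hχl, hχr, hχT⟩ := ManovaU.exists_smooth_cutoff
  set c₀ : ℝ := Real.exp (1 / 2) * ManovaU.gaussNegMoment.toReal with hc₀
  have hc₀0 : 0 ≤ c₀ := mul_nonneg (Real.exp_pos _).le ENNReal.toReal_nonneg
  set Cq : ℝ → ℝ := fun q => c₀ + (ENNReal.ofReal L * ManovaU.lindebergConst q).toReal + 1
  -- The power makes C w times imbalance^(1/5) at least one beyond the threshold. The absolute value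
  -- and the +1 keep C w positive for every real w, including the zeros of the base.
  set C : ℝ → ℝ := fun w => (|(1 - w) * (1 - 2 * w) / 2|) ^ (-(1 / 5) : ℝ) + 1
  have main : ∀ q : ℝ, 2 < q → q ≤ 3 → ∀ w : ℝ, w < 1 / 2 →
      ∀ M : ManovaU.RegressionModel.{u}, (∀ i, M.P0 i i ≤ w) → M.Null →
        ENNReal.ofReal M.rho ≤ M.bound q (Cq q) (C w) := by
    intro q hq hq3 w hw M hd hN
    have hc : 0 < (1 - w) * (1 - 2 * w) / 2 := by
      refine div_pos (mul_pos ?_ ?_) two_pos <;> linarith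
    rcases le_or_gt M.imbalance ((1 - w) * (1 - 2 * w) / 2) with himb | himb
    · refine le_trans ?_ (self_le_add_right _ _)
      exact ManovaU.le_mul_rpow_of_forall_le (by linarith) hc₀0
        (ENNReal.mul_ne_top ENNReal.ofReal_ne_top (ManovaU.lindebergConst_ne_top (by linarith)))
        fun η hη => ManovaU.RegressionModel.ofReal_rho_le hw hd hN himb hq hq3 hL.le hχc hχ0 hχ1
          hχl hχr ⟨χ', χ'', hχT q hq hq3⟩ hη
    -- Large imbalance: the Kolmogorov distance is at most one, and the second term already exceeds
    -- it.
    · refine le_trans ?_ (self_le_add_left _ _)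
      refine ENNReal.ofReal_le_ofReal ?_
      have := M.isProbabilityMeasure_law
      have hprob : IsProbabilityMeasure M.gaussLaw := by
        rw [ManovaU.RegressionModel.gaussLaw]; infer_instance
      refine (ManovaU.kolmogorovDist_le_one (P := M.prob) (P' := M.gaussLaw)).trans ?_
      have h1 := Real.rpow_le_rpow hc.le himb.le (by norm_num : (0 : ℝ) ≤ 1 / 5)
      have h2 : 0 < ((1 - w) * (1 - 2 * w) / 2) ^ (1 / 5 : ℝ) := Real.rpow_pos_of_pos hc _
      have h3 : (|(1 - w) * (1 - 2 * w) / 2|) ^ (-(1 / 5) : ℝ) *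
          ((1 - w) * (1 - 2 * w) / 2) ^ (1 / 5 : ℝ) = 1 := by
        rw [abs_of_pos hc, Real.rpow_neg hc.le, inv_mul_cancel₀ h2.ne']
      have h4 : 0 ≤ (|(1 - w) * (1 - 2 * w) / 2|) ^ (-(1 / 5) : ℝ) := by positivity
      calc (1 : ℝ) ≤ (|(1 - w) * (1 - 2 * w) / 2|) ^ (-(1 / 5) : ℝ) *
            M.imbalance ^ (1 / 5 : ℝ) := h3.symm.le.trans (mul_le_mul_of_nonneg_left h1 h4)
        _ ≤ C w * M.imbalance ^ (1 / 5 : ℝ) :=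
            mul_le_mul_of_nonneg_right (by simp [C]) (h2.le.trans h1)
  refine ⟨Cq, C, fun q => ?_, fun w => ?_, fun q hq hq3 w _ hw => ⟨fun M hd hN => ⟨fun i => ?_,
    fun ω => ManovaU.RegressionModel.U_eq_quadForm hN ω, main q hq hq3 w hw M hd hN⟩,
    fun M hd hN himb hΔ => ?_⟩⟩
  · have : 0 ≤ (ENNReal.ofReal L * ManovaU.lindebergConst q).toReal := ENNReal.toReal_nonneg
    change 0 < c₀ + _ + 1
    linarith
  · change 0 < (|(1 - w) * (1 - 2 * w) / 2|) ^ (-(1 / 5) : ℝ) + 1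
    positivity
  · exact ManovaU.Ptheta_diag M.X M.C M.rank_X M.rank_C hw hd i
  · have hb := ManovaU.RegressionModel.tendsto_bound (by linarith : 0 < q) (Cq q) (C w) himb hΔ
    refine ⟨hb, ?_⟩
    have h1 : Tendsto (fun k => ENNReal.ofReal (M k).rho) atTop (𝓝 0) :=
      tendsto_of_tendsto_of_tendsto_of_le_of_le tendsto_const_nhds hb (fun _ => zero_le)
        fun k => main q hq hq3 w hw (M k) (hd k) (hN k)
    have h2 := (ENNReal.tendsto_toReal ENNReal.zero_ne_top).comp h1
    refine h2.congr fun k => ?_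
    exact ENNReal.toReal_ofReal ManovaU.kolmogorovDist_nonneg
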